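/- Let $\Bbbk$ be a field of characteristic zero, let $S\subseteq\mathbb N$ be a numerical semigroup (a submonoid of $(\mathbb N,+)$ with finite complement), and let $0\neq n\in S$, for instance the multiplicity of $S$. Let $\mathrm{Ap}(S,n)=\{s\in S : s-n\notin S\}$ be the Apéry set, let $Q=\Bbbk[S]/(t^n)=\Bbbk[S]/(t^s : s\in S\setminus \mathrm{Ap}(S,n))$, a local Artinian algebra with $\Bbbk$-basis $\{t^\omega : \omega\in\mathrm{Ap}(S,n)\}$ and maximal ideal $\mathfrak m=(t^s : 0\ne s\in S)$, and let \[A=\operatorname{gr}_{\mathfrak m}(Q)=\bigoplus_{i\ge 0}\mathfrak m^i/\mathfrak m^{i+1}\] be the graded algebra arising from the Apéry set. Suppose that $A$ has codimension three, that is, $\dim_\Bbbk A_1=3$, and that $A$ is Gorenstein, that is, its socle is one-dimensional over $\Bbbk$. Then: 1. $A$ has the strong Lefschetz property: there is a linear form $\ell\in A_1$ such that for all $i,d\ge 0$ the multiplication map $\ell^d\colon A_i\to A_{i+d}$ has maximal rank (is injective or surjective). 2. There are integers $0\le\alpha_j\le d_j$ $(j=1,2,3)$ with $d_1=\alpha_2+\alpha_3$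 such that $A$ is isomorphic, as a graded $\Bbbk$-algebra, to $\Bbbk[x_1,x_2,x_3]/K'$, where \[K'=(x_1^{d_1}-x_2^{\alpha_2}x_3^{\alpha_3},\ x_2^{d_2},\ x_3^{d_3})+x_1^{d_1-\alpha_1}(x_2^{d_2-\alpha_2},\ x_3^{d_3-\alpha_3}).\] -/

import Mathlib

noncomputable section

/-- A numerical semigroup: a submonoid of `(ℕ, +)` with finite complement. -/
def IsNumericalSemigroup (S : AddSubmonoid ℕ) : Prop :=
  ((S : Set ℕ)ᶜ).Finite

/-- The Apéry set `Ap(S, n) = {s ∈ S : s - n ∉ S}`. -/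
def aperySet (S : AddSubmonoid ℕ) (n : ℕ) : Set ℕ :=
  {s | s ∈ S ∧ ¬ ∃ u ∈ S, s = u + n}

/-- The monomial `t ^ s` of the semigroup ring `K[S]`. -/
def semigroupMonomial (K : Type*) [Field K] (S : AddSubmonoid ℕ) (s : S) :
    AddMonoidAlgebra K S :=
  AddMonoidAlgebra.single s 1

/-- The ideal of `K[S]` generated by the monomials `t ^ s` with `s ∈ S` outside `Ap(S, n)`. For
`n ∈ S` it is the principal ideal `(t ^ n)`, see `aperyIdeal_eq_span`. -/
def aperyIdeal (K : Type*) [Field K] (S : AddSubmonoid ℕ) (n : ℕ) :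
    Ideal (AddMonoidAlgebra K S) :=
  Ideal.span (semigroupMonomial K S '' {s : S | (s : ℕ) ∉ aperySet S n})

theorem aperyIdeal_eq_span (K : Type*) [Field K] (S : AddSubmonoid ℕ) (n : S) :
    aperyIdeal K S n = Ideal.span {semigroupMonomial K S n} := by
  apply le_antisymm
  · refine Ideal.span_le.2 ?_
    rintro _ ⟨s, hs, rfl⟩
    have hs' : ∃ u ∈ S, (s : ℕ) = u + n := by
      by_contra h
      exact hs ⟨s.2, h⟩
    obtain ⟨u, hu, h⟩ := hs'
    have e : s = ⟨u, hu⟩ + n := Subtype.ext h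
    refine Ideal.mem_span_singleton'.2 ⟨semigroupMonomial K S ⟨u, hu⟩, ?_⟩
    rw [e]
    simp [semigroupMonomial, AddMonoidAlgebra.single_mul_single]
  · refine Ideal.span_mono ?_
    rintro _ rfl
    exact ⟨n, fun h => h.2 ⟨0, S.zero_mem, by simp⟩, rfl⟩

/-- The local Artinian algebra `K[S] / (t ^ n)`, with `K`-basis the residue classes of the `t ^ ω`,
`ω ∈ Ap(S, n)`. -/
abbrev AperyRing (K : Type*) [Field K] (S : AddSubmonoid ℕ) (n : ℕ) : Type _ :=
  AddMonoidAlgebra K S ⧸ aperyIdeal K S n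

/-- The maximal ideal of `K[S] / (t ^ n)`, generated by the classes of `t ^ s`, `0 ≠ s ∈ S`. -/
def aperyMaximalIdeal (K : Type*) [Field K] (S : AddSubmonoid ℕ) (n : ℕ) :
    Ideal (AperyRing K S n) :=
  (Ideal.span (semigroupMonomial K S '' {s : S | s ≠ 0})).map
    (Ideal.Quotient.mk (aperyIdeal K S n))

/-- The associated graded ring `⨁ᵢ Iⁱ / Iⁱ⁺¹`, as the quotient of the Rees algebra
`⨁ᵢ Iⁱ Xⁱ` by its ideal generated by `I`, i.e. by `⨁ᵢ Iⁱ⁺¹ Xⁱ`. -/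
def AssociatedGradedRing {Q : Type*} [CommRing Q] (I : Ideal Q) : Type _ :=
  reesAlgebra I ⧸ I.map (algebraMap Q (reesAlgebra I))

instance {Q : Type*} [CommRing Q] (I : Ideal Q) : CommRing (AssociatedGradedRing I) :=
  inferInstanceAs (CommRing (reesAlgebra I ⧸ I.map (algebraMap Q (reesAlgebra I))))

instance (K : Type*) [Field K] {Q : Type*} [CommRing Q] [Algebra K Q] (I : Ideal Q) :
    Algebra K (AssociatedGradedRing I) :=
  inferInstanceAs (Algebra K (reesAlgebra I ⧸ I.map (algebraMap Q (reesAlgebra I))))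

/-- The quotient map from the Rees algebra to the associated graded ring. -/
def associatedGradedMk (K : Type*) [Field K] {Q : Type*} [CommRing Q] [Algebra K Q]
    (I : Ideal Q) : reesAlgebra I →ₐ[K] AssociatedGradedRing I :=
  Ideal.Quotient.mkₐ K (I.map (algebraMap Q (reesAlgebra I)))

/-- The component `Iⁱ / Iⁱ⁺¹` of the associated graded ring: the classes of the elements `r Xⁱ`,
`r ∈ Iⁱ`, of the Rees algebra. -/
def associatedGradedPiece (K : Type*) [Field K] {Q : Type*} [CommRing Q] [Algebra K Q]
    (I : Ideal Q) (i : ℕ) : Submodule K (AssociatedGradedRing I) :=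
  (Submodule.comap ((reesAlgebra I).val.restrictScalars K).toLinearMap
    ((LinearMap.range (Polynomial.monomial (R := Q) i)).restrictScalars K)).map
    (associatedGradedMk K I).toLinearMap

/-- The graded algebra arising from the Apéry set `Ap(S, n)`: the associated graded ring of
`K[S] / (t ^ n)` with respect to its maximal ideal. -/
abbrev AperyAlgebra (K : Type*) [Field K] (S : AddSubmonoid ℕ) (n : ℕ) : Type _ :=
  AssociatedGradedRing (aperyMaximalIdeal K S n)

/-- The homogeneous components of `AperyAlgebra K S n`. -/
def aperyGrading (K : Type*) [Field K] (S : AddSubmonoid ℕ) (n : ℕ) (i : ℕ) :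
    Submodule K (AperyAlgebra K S n) :=
  associatedGradedPiece K (aperyMaximalIdeal K S n) i

section Graded

variable {K : Type*} [Field K] {A : Type*} [CommRing A] [Algebra K A]

/-- The socle of a graded algebra: the annihilator of all elements of positive degree. -/
def gradedSocle (𝒜 : ℕ → Submodule K A) : Submodule K A where
  carrier := {a | ∀ i, 0 < i → ∀ x ∈ 𝒜 i, x * a = 0}
  add_mem' := by
    intro a b ha hb i hi x hx
    rw [mul_add, ha i hi x hx, hb i hi x hx, add_zero]
  zero_mem' := by
    intro i _ x _
    exact mul_zero x
  smul_mem' := by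
    intro c a ha i hi x hx
    rw [mul_smul_comm, ha i hi x hx, smul_zero]

/-- A standard graded Artinian algebra (with `K` in degree zero) is Gorenstein if its socle is
one-dimensional. -/
def IsGradedGorenstein (𝒜 : ℕ → Submodule K A) : Prop :=
  Module.finrank K (gradedSocle 𝒜) = 1

/-- The strong Lefschetz property: for some linear form `ℓ`, each multiplication map
`ℓ ^ d : 𝒜 i → 𝒜 (i + d)` has maximal rank, that is, is injective or surjective. -/
def HasSLP (𝒜 : ℕ → Submodule K A) : Prop :=
  ∃ ℓ ∈ 𝒜 1, ∀ i d : ℕ,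
    Set.InjOn (fun a => ℓ ^ d * a) (𝒜 i : Set A) ∨
      Set.SurjOn (fun a => ℓ ^ d * a) (𝒜 i : Set A) (𝒜 (i + d) : Set A)

end Graded

/-- The ideal
`(x₀^d₀ + c x₁^α₁ x₂^α₂, x₁^d₁, x₂^d₂) + x₀^(d₀-α₀) (x₁^(d₁-α₁), x₂^(d₂-α₂))`
of `K[x₀, x₁, x₂]`; it is used for `α ≤ d` only. -/
def binomialIdeal (K : Type*) [Field K] (c : K) (d α : Fin 3 → ℕ) :
    Ideal (MvPolynomial (Fin 3) K) :=
  Ideal.span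
    {MvPolynomial.X 0 ^ d 0 +
        MvPolynomial.C c * (MvPolynomial.X 1 ^ α 1 * MvPolynomial.X 2 ^ α 2),
      MvPolynomial.X 1 ^ d 1, MvPolynomial.X 2 ^ d 2,
      MvPolynomial.X 0 ^ (d 0 - α 0) * MvPolynomial.X 1 ^ (d 1 - α 1),
      MvPolynomial.X 0 ^ (d 0 - α 0) * MvPolynomial.X 2 ^ (d 2 - α 2)}

/-- The degree `i` component of `K[x₀, x₁, x₂] / J` for a homogeneous ideal `J`. -/
def quotientGrading {K : Type*} [Field K] (J : Ideal (MvPolynomial (Fin 3) K)) (i : ℕ) :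
    Submodule K (MvPolynomial (Fin 3) K ⧸ J) :=
  (MvPolynomial.homogeneousSubmodule (Fin 3) K i).map (Ideal.Quotient.mkₐ K J).toLinearMap

end

/-!
The algebra `A` is spanned by the initial forms of the `t ^ s` with `s` in the Apéry set, so the
only relations between monomials in the three degree-one classes are that a monomial vanishes, or
that two monomials of the same degree and the same weight in `S` agree. Order the three generators
so that `g₁ < g₀ < g₂`; the exponents with the same degree and weight then differ by multiples of a
single vector `(p + q, -q, -p)`. As the socle is one-dimensional, all maximal nonvanishing monomials
have the same class, hence the nonvanishing monomials are the divisors of one monomial up to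
translation by that vector. Reading off the relations gives `x₀ ^ d₀ = x₁ ^ α₁ * x₂ ^ α₂` and the
other generators of `K'`.

For the strong Lefschetz property, scaling `x₀` turns the binomial relation into
`x₀ ^ d₀ = c x₁ ^ α₁ * x₂ ^ α₂`, and `c → 0` degenerates `A` to a monomial algebra with the same
normal monomials. There, injectivity of multiplication by the powers of `x₀ + x₁ + x₂` reduces to
ideals generated by powers of the variables, where it follows from an action of `𝔰𝔩₂` in
characteristic zero. Injectivity at `c = 0` of a matrix with polynomial entries persists for all but
finitely many `c`, and the symmetry of the Hilbert function turns injectivity below the middle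
degree into maximal rank everywhere.
-/

noncomputable section

section Casimir

variable {R : Type*} [Ring R] {E F H : R}

/-- The Casimir element `4FE + H² + 2H` of an `sl₂`-triple `(E, F, H)`. -/
def casimir (E F H : R) : R :=
  4 * (F * E) + H ^ 2 + 2 * H

theorem casimir_eq_sub (hEF : ⁅E, F⁆ = H) : casimir E F H = 4 * (E * F) + H ^ 2 - 2 * H := by
  have hH : H = E * F - F * E := by rw [← hEF, Ring.lie_def]
  calc casimir E F H = 4 * (E * F) + H ^ 2 - 2 * H + 4 * (H - (E * F - F * E)) := by
        rw [casimir]; noncomm_ring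
    _ = 4 * (E * F) + H ^ 2 - 2 * H := by rw [← hH, sub_self, mul_zero, add_zero]

theorem commute_casimir_raising (hEF : ⁅E, F⁆ = H) (hHE : ⁅H, E⁆ = 2 • E) :
    Commute (casimir E F H) E :=
  commute_iff_lie_eq.2 <|
    calc ⁅casimir E F H, E⁆
        = H * ⁅H, E⁆ + ⁅H, E⁆ * H + 2 * ⁅H, E⁆ - 4 * (⁅E, F⁆ * E) := by
          simp only [casimir, Ring.lie_def]; noncomm_ring
      _ = H * (2 • E) + 2 • E * H + 2 * 2 • E - 4 * (H * E) := by rw [hEF, hHE]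
      _ = 2 * (2 • E - ⁅H, E⁆) := by rw [Ring.lie_def]; noncomm_ring
      _ = 0 := by rw [hHE, sub_self, mul_zero]

theorem commute_casimir_lowering (hEF : ⁅E, F⁆ = H) (hHF : ⁅H, F⁆ = -(2 • F)) :
    Commute (casimir E F H) F :=
  commute_iff_lie_eq.2 <|
    calc ⁅casimir E F H, F⁆
        = H * ⁅H, F⁆ + ⁅H, F⁆ * H + 2 * ⁅H, F⁆ + 4 * (F * ⁅E, F⁆) := by
          simp only [casimir, Ring.lie_def]; noncomm_ring
      _ = H * -(2 • F) + -(2 • F) * H + 2 * -(2 • F) + 4 * (F * H) := by rw [hEF, hHF]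
      _ = 2 * (-(2 • F) - ⁅H, F⁆) := by rw [Ring.lie_def]; noncomm_ring
      _ = 0 := by rw [hHF, sub_self, mul_zero]

theorem commute_casimir_weight (hHE : ⁅H, E⁆ = 2 • E) (hHF : ⁅H, F⁆ = -(2 • F)) :
    Commute (casimir E F H) H :=
  commute_iff_lie_eq.2 <|
    calc ⁅casimir E F H, H⁆ = -4 * (F * ⁅H, E⁆ + ⁅H, F⁆ * E) := by
          simp only [casimir, Ring.lie_def]; noncomm_ring
      _ = 0 := by rw [hHE, hHF]; noncomm_ring

end Casimir

section Sl2

variable {K V : Type*} [Field K] [AddCommGroup V] [Module K V] {E F H : Module.End K V}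

theorem weight_pow_apply {a w : K} {v : V} (hHE : ⁅H, E⁆ = a • E) (hv : H v = w • v) (s : ℕ) :
    H ((E ^ s) v) = (w + s * a) • (E ^ s) v := by
  induction s with
  | zero => simpa using hv
  | succ s ih =>
    have hE : H (E ((E ^ s) v)) = E (H ((E ^ s) v)) + a • E ((E ^ s) v) :=
      eq_add_of_sub_eq' (LinearMap.congr_fun hHE _)
    rw [pow_succ', Module.End.mul_apply, hE, ih, map_smul]
    push_cast
    module

theorem exists_lowering_eq_zero {w : ℤ} {v : V} (hHF : ⁅H, F⁆ = -(2 • F))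
    (hv : H v = (w : K) • v) (hv0 : v ≠ 0) (hF : ∃ N, (F ^ N) v = 0) :
    ∃ N : ℕ, (F ^ N) v ≠ 0 ∧ F ((F ^ N) v) = 0 ∧
      H ((F ^ N) v) = ((w - 2 * N : ℤ) : K) • (F ^ N) v := by
  classical
  obtain ⟨N, hN⟩ : ∃ N, Nat.find hF = N + 1 :=
    Nat.exists_eq_succ_of_ne_zero fun h => hv0 (by simpa [h] using Nat.find_spec hF)
  refine ⟨N, Nat.find_min hF (by omega), ?_, ?_⟩
  · rw [← Module.End.mul_apply, ← pow_succ', ← hN]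
    exact Nat.find_spec hF
  · have hHF' : ⁅H, F⁆ = (-2 : K) • F := by rw [hHF]; module
    rw [weight_pow_apply hHF' hv]
    push_cast
    module

theorem eq_zero_of_raising_pow_eq_zero [CharZero K] (hEF : ⁅E, F⁆ = H) (hHE : ⁅H, E⁆ = 2 • E)
    (hHF : ⁅H, F⁆ = -(2 • F)) (hF : ∀ v, ∃ N, (F ^ N) v = 0) {w : ℤ} {s : ℕ} (hs : (s : ℤ) ≤ -w)
    {v : V} (hv : H v = (w : K) • v) (hE : (E ^ s) v = 0) : v = 0 := by
  induction s generalizing v with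
  | zero => simpa using hE
  | succ s ih =>
    by_contra hv0
    set μ : ℤ := w + 2 * s with hμ
    have hCv : casimir E F H v = ((μ * (μ + 2) : ℤ) : K) • v := by
      refine sub_eq_zero.1 (ih (by push_cast at hs; omega) ?_ ?_)
      · rw [map_sub, ← Module.End.mul_apply, ← (commute_casimir_weight hHE hHF).eq,
          Module.End.mul_apply, hv, map_smul, map_smul, hv]
        module
      · have hHE' : ⁅H, E⁆ = (2 : K) • E := by rw [hHE]; module
        have hFE : F (E ((E ^ s) v)) = 0 := by
          rw [← Module.End.mul_apply E, ← pow_succ', hE, map_zero]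
        rw [map_sub, ← Module.End.mul_apply, ← ((commute_casimir_raising hEF hHE).pow_right s).eq,
          Module.End.mul_apply, casimir]
        simp only [pow_two, LinearMap.add_apply, Module.End.mul_apply, hFE, Module.End.ofNat_apply,
          nsmul_zero, weight_pow_apply hHE' hv, map_smul, zero_add, hμ]
        push_cast
        module
    obtain ⟨N, hz0, hFz, hHz⟩ := exists_lowering_eq_zero hHF hv hv0 (hF v)
    set ν : ℤ := w - 2 * N
    have hCz : casimir E F H ((F ^ N) v) = ((ν * (ν - 2) : ℤ) : K) • (F ^ N) v := by
      rw [casimir_eq_sub hEF]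
      simp only [pow_two, LinearMap.sub_apply, LinearMap.add_apply, Module.End.mul_apply, hFz,
        map_zero, Module.End.ofNat_apply, hHz, map_smul, zero_add]
      push_cast
      module
    have hμν : μ * (μ + 2) = ν * (ν - 2) := by
      have h := LinearMap.congr_fun
        ((commute_casimir_lowering hEF hHF).pow_right N).eq v
      rw [Module.End.mul_apply, Module.End.mul_apply, hCz, hCv, map_smul] at h
      exact_mod_cast (smul_left_injective K hz0 h).symm
    have h : (μ + ν) * (μ - ν + 2) = 0 := by linear_combination hμν
    push_cast at hs
    rcases mul_eq_zero.1 h with h | h <;> omega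

theorem mem_of_raising_pow_mem [CharZero K] (hEF : ⁅E, F⁆ = H) (hHE : ⁅H, E⁆ = 2 • E)
    (hHF : ⁅H, F⁆ = -(2 • F)) {J : Submodule K V} (hEJ : J ≤ J.comap E) (hFJ : J ≤ J.comap F)
    (hF : ∀ v, ∃ N, (F ^ N) v = 0) {w : ℤ} {s : ℕ} (hs : (s : ℤ) ≤ -w) {v : V}
    (hv : H v = (w : K) • v) (hE : (E ^ s) v ∈ J) : v ∈ J := by
  have hHJ : J ≤ J.comap H := fun x hx => by
    rw [← hEF]
    exact J.sub_mem (hEJ (hFJ hx)) (hFJ (hEJ hx))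
  rw [← J.ker_mkQ, LinearMap.mem_ker]
  refine eq_zero_of_raising_pow_eq_zero (E := J.mapQ J E hEJ) (F := J.mapQ J F hFJ)
    (H := J.mapQ J H hHJ) ?_ ?_ ?_ ?_ hs ?_ ?_
  · refine Submodule.linearMap_qext _ (LinearMap.ext fun x => ?_)
    exact congrArg J.mkQ (LinearMap.congr_fun hEF x)
  · refine Submodule.linearMap_qext _ (LinearMap.ext fun x => ?_)
    exact congrArg J.mkQ (LinearMap.congr_fun hHE x)
  · refine Submodule.linearMap_qext _ (LinearMap.ext fun x => ?_)
    exact congrArg J.mkQ (LinearMap.congr_fun hHF x)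
  · refine J.mkQ_surjective.forall.2 fun x => ?_
    obtain ⟨N, hN⟩ := hF x
    refine ⟨N, ?_⟩
    rw [← Submodule.mapQ_pow, Submodule.mkQ_apply, Submodule.mapQ_apply, hN,
      Submodule.Quotient.mk_zero]
  · exact congrArg J.mkQ hv
  · rw [← Submodule.mapQ_pow, Submodule.mkQ_apply, Submodule.mapQ_apply]
    exact (Submodule.Quotient.mk_eq_zero J).2 hE

end Sl2

theorem lie_sum_sum_of_pairwise {R ι : Type*} [Ring R] [Fintype ι] [DecidableEq ι] {e f h : ι → R}
    (H : ∀ i j, ⁅e i, f j⁆ = if i = j then h i else 0) : ⁅∑ i, e i, ∑ i, f i⁆ = ∑ i, h i := by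
  calc ⁅∑ i, e i, ∑ i, f i⁆ = ∑ i, ∑ j, ⁅e i, f j⁆ := by
        simp only [Ring.lie_def, Finset.sum_sub_distrib, ← Finset.mul_sum, ← Finset.sum_mul]
    _ = ∑ i, h i := by simp [H]

section PurePower

open MvPolynomial

variable {R σ : Type*} [CommRing R]

/-- The ideal `(Xᵢ ^ nᵢ)` of a monomial complete intersection. -/
def purePowerIdeal (R : Type*) [CommRing R] (n : σ → ℕ) : Ideal (MvPolynomial σ R) :=
  Ideal.span ((fun m => monomial m 1) '' Set.range fun i => Finsupp.single i (n i))

theorem mem_purePowerIdeal {n : σ → ℕ} {p : MvPolynomial σ R} :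
    p ∈ purePowerIdeal R n ↔ ∀ m ∈ p.support, ∃ i, n i ≤ m i := by
  simp [purePowerIdeal, mem_ideal_span_monomial_image]

theorem monomial_mem_purePowerIdeal {n : σ → ℕ} {m : σ →₀ ℕ} {i : σ} (hi : n i ≤ m i) (a : R) :
    monomial m a ∈ purePowerIdeal R n :=
  mem_purePowerIdeal.2 fun m' hm' => ⟨i, by
    rwa [Finset.mem_singleton.1 (support_monomial_subset hm')]⟩

/-- The part in the variable `Xᵢ` of the lowering operator of the action of `sl₂` on polynomials
which descends to the quotient by `(Xᵢ ^ nᵢ)` and for which `∑ i, Xᵢ` is the raising operator. -/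
def lowering (R : Type*) [CommRing R] (n : σ → ℕ) (i : σ) : Module.End R (MvPolynomial σ R) :=
  ((n i : R) - 1) • (pderiv i).toLinearMap -
    LinearMap.mulLeft R (X i) * (pderiv i).toLinearMap * (pderiv i).toLinearMap

/-- The part in the variable `Xᵢ` of the weight operator of the action of `sl₂` whose lowering
operator is `lowering`. -/
def weighing (R : Type*) [CommRing R] (n : σ → ℕ) (i : σ) : Module.End R (MvPolynomial σ R) :=
  2 • (LinearMap.mulLeft R (X i) * (pderiv i).toLinearMap) - ((n i : R) - 1) • 1

theorem lowering_apply (n : σ → ℕ) (i : σ) (p : MvPolynomial σ R) :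
    lowering R n i p = C ((n i : R) - 1) * pderiv i p - X i * pderiv i (pderiv i p) := by
  simp [lowering, smul_eq_C_mul]

theorem weighing_apply (n : σ → ℕ) (i : σ) (p : MvPolynomial σ R) :
    weighing R n i p = 2 * (X i * pderiv i p) - C ((n i : R) - 1) * p := by
  simp [weighing, smul_eq_C_mul]

theorem lowering_monomial (n : σ → ℕ) (i : σ) (m : σ →₀ ℕ) (a : R) :
    lowering R n i (monomial m a) =
      monomial (m - Finsupp.single i 1) (m i * (n i - m i) * a) := by
  rw [lowering_apply, pderiv_monomial, pderiv_monomial, C_mul_monomial]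
  have hX : X i * monomial (m - Finsupp.single i 1 - Finsupp.single i 1)
      (a * m i * ((m - Finsupp.single i 1 : σ →₀ ℕ) i : R)) =
        monomial (m - Finsupp.single i 1) (a * m i * (m i - 1)) := by
    obtain h | h | h : m i = 0 ∨ m i = 1 ∨ 1 ≤ (m - Finsupp.single i 1 : σ →₀ ℕ) i := by
      rw [Finsupp.tsub_apply, Finsupp.single_eq_same]
      omega
    · simp [h]
    · simp [h]
    · rw [← pow_one (X i), ← monomial_single_add,
        add_tsub_cancel_of_le (Finsupp.single_le_iff.2 h)]
      rw [Finsupp.tsub_apply, Finsupp.single_eq_same] at h ⊢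
      rw [Nat.cast_sub (by omega), Nat.cast_one]
  rw [hX, ← map_sub]
  congr 1
  ring

theorem lowering_mem_purePowerIdeal (n : σ → ℕ) (i : σ) {p : MvPolynomial σ R}
    (hp : p ∈ purePowerIdeal R n) : lowering R n i p ∈ purePowerIdeal R n := by
  rw [p.as_sum, map_sum]
  refine Ideal.sum_mem _ fun m hm => ?_
  obtain ⟨j, hj⟩ := mem_purePowerIdeal.1 hp m hm
  rw [lowering_monomial]
  by_cases hm' : n i = m i
  · simp [hm']
  · refine monomial_mem_purePowerIdeal (i := j) ?_ _
    by_cases hij : i = j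
    · subst hij
      simp only [Finsupp.coe_tsub, Pi.sub_apply, Finsupp.single_eq_same]
      omega
    · simpa [hij] using hj

theorem pderiv_pderiv_comm (i j : σ) (p : MvPolynomial σ R) :
    pderiv i (pderiv j p) = pderiv j (pderiv i p) := by
  have h : ⁅(pderiv i : Derivation R (MvPolynomial σ R) (MvPolynomial σ R)),
      (pderiv j : Derivation R (MvPolynomial σ R) (MvPolynomial σ R))⁆ = 0 := by
    classical
    refine derivation_ext fun k => ?_
    rw [Derivation.commutator_apply, pderiv_X, pderiv_X, Pi.single_apply, Pi.single_apply]
    split_ifs <;> simp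
  exact sub_eq_zero.1 (DFunLike.congr_fun h p)

theorem lie_mulLeft_lowering [DecidableEq σ] (n : σ → ℕ) (i j : σ) :
    ⁅LinearMap.mulLeft R (X i : MvPolynomial σ R), lowering R n j⁆ =
      if i = j then weighing R n i else 0 := by
  refine LinearMap.ext fun p => ?_
  obtain rfl | h := eq_or_ne i j
  · simp only [Ring.lie_def, LinearMap.sub_apply, Module.End.mul_apply, LinearMap.mulLeft_apply,
      lowering_apply, C_sub, map_natCast, C_1, Derivation.leibniz, smul_eq_mul, pderiv_X,
      Pi.single_eq_same, mul_one, map_add, ↓reduceIte, weighing_apply]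
    ring
  · simp only [Ring.lie_def, LinearMap.sub_apply, Module.End.mul_apply, LinearMap.mulLeft_apply,
      lowering_apply, C_sub, map_natCast, C_1, Derivation.leibniz, smul_eq_mul, pderiv_X, ne_eq, h,
      not_false_eq_true, Pi.single_eq_of_ne, mul_zero, add_zero, ↓reduceIte, LinearMap.zero_apply]
    ring

theorem lie_weighing_mulLeft [DecidableEq σ] (n : σ → ℕ) (i j : σ) :
    ⁅weighing R n i, LinearMap.mulLeft R (X j : MvPolynomial σ R)⁆ =
      if i = j then 2 • LinearMap.mulLeft R (X i : MvPolynomial σ R) else 0 := by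
  refine LinearMap.ext fun p => ?_
  obtain rfl | h := eq_or_ne i j
  · simp only [Ring.lie_def, LinearMap.sub_apply, Module.End.mul_apply, LinearMap.mulLeft_apply,
      weighing_apply, Derivation.leibniz, smul_eq_mul, pderiv_X, C_sub, map_natCast, C_1,
      Pi.single_eq_same, mul_one, ↓reduceIte, nsmul_eq_mul, Nat.cast_ofNat, Module.End.ofNat_apply]
    ring
  · simp only [Ring.lie_def, LinearMap.sub_apply, Module.End.mul_apply, LinearMap.mulLeft_apply,
      weighing_apply, Derivation.leibniz, smul_eq_mul, pderiv_X, C_sub, map_natCast, C_1, ne_eq, h,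
      not_false_eq_true, Pi.single_eq_of_ne', mul_zero, add_zero, ↓reduceIte, LinearMap.zero_apply]
    ring

theorem lie_weighing_lowering [DecidableEq σ] (n : σ → ℕ) (i j : σ) :
    ⁅weighing R n i, lowering R n j⁆ = if i = j then -(2 • lowering R n i) else 0 := by
  refine LinearMap.ext fun p => ?_
  obtain rfl | h := eq_or_ne i j
  · simp only [Ring.lie_def, LinearMap.sub_apply, Module.End.mul_apply, lowering_apply,
      weighing_apply, map_natCast, C_1, map_sub, map_add, Derivation.leibniz,
      Derivation.map_natCast, Derivation.map_one_eq_zero, smul_eq_mul, sub_self, mul_zero, add_zero,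
      two_mul, pderiv_X, Pi.single_eq_same, mul_one, ↓reduceIte, nsmul_eq_mul, Nat.cast_ofNat,
      neg_add_rev, LinearMap.add_apply, LinearMap.neg_apply, neg_sub]
    ring
  · simp only [Ring.lie_def, LinearMap.sub_apply, Module.End.mul_apply, lowering_apply,
      weighing_apply, map_natCast, C_1, map_sub, map_add, Derivation.leibniz,
      Derivation.map_natCast, Derivation.map_one_eq_zero, smul_eq_mul, sub_self, mul_zero, add_zero,
      two_mul, pderiv_X, ne_eq, Ne.symm h, not_false_eq_true, Pi.single_eq_of_ne,
      pderiv_pderiv_comm j i, h, ↓reduceIte, LinearMap.zero_apply]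
    ring

variable [Fintype σ]

theorem lie_sum_mulLeft_sum_lowering (n : σ → ℕ) :
    ⁅∑ i, LinearMap.mulLeft R (X i : MvPolynomial σ R), ∑ i, lowering R n i⁆ =
      ∑ i, weighing R n i := by
  classical
  exact lie_sum_sum_of_pairwise (lie_mulLeft_lowering n)

theorem lie_sum_weighing_sum_mulLeft (n : σ → ℕ) :
    ⁅∑ i, weighing R n i, ∑ i, LinearMap.mulLeft R (X i : MvPolynomial σ R)⁆ =
      2 • ∑ i, LinearMap.mulLeft R (X i : MvPolynomial σ R) := by
  classical
  rw [Finset.smul_sum]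
  exact lie_sum_sum_of_pairwise (lie_weighing_mulLeft n)

theorem lie_sum_weighing_sum_lowering (n : σ → ℕ) :
    ⁅∑ i, weighing R n i, ∑ i, lowering R n i⁆ = -(2 • ∑ i, lowering R n i) := by
  classical
  rw [Finset.smul_sum, ← Finset.sum_neg_distrib]
  exact lie_sum_sum_of_pairwise (lie_weighing_lowering n)

theorem sum_weighing_apply (n : σ → ℕ) {k : ℕ} {p : MvPolynomial σ R} (hp : p.IsHomogeneous k) :
    (∑ i, weighing R n i) p =
      (((2 * k + Fintype.card σ : ℤ) - ∑ i, (n i : ℤ) : ℤ) : R) • p := by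
  have h := hp.sum_X_mul_pderiv
  simp only [LinearMap.sum_apply, weighing_apply, Finset.sum_sub_distrib, ← Finset.mul_sum, h,
    ← Finset.sum_mul, smul_eq_C_mul]
  simp only [nsmul_eq_mul, C_sub, map_natCast, C_1, Finset.sum_sub_distrib, Finset.sum_const,
    Finset.card_univ, mul_one, Int.cast_sub, Int.cast_add, Int.cast_mul, Int.cast_ofNat,
    Int.cast_natCast, Int.cast_sum, C_add, C_mul, map_ofNat C 2, map_sum]
  ring

theorem sum_lowering_pow_monomial (n : σ → ℕ) {N : ℕ} {m : σ →₀ ℕ} (hm : m.degree < N) (a : R) :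
    ((∑ i, lowering R n i) ^ N) (monomial m a) = 0 := by
  induction N generalizing m a with
  | zero => omega
  | succ N ih =>
    rw [pow_succ, Module.End.mul_apply, LinearMap.sum_apply, map_sum]
    refine Finset.sum_eq_zero fun i _ => ?_
    rw [lowering_monomial]
    obtain hi | hi := Nat.eq_zero_or_pos (m i)
    · simp [hi]
    · refine ih ?_ _
      have h := map_add Finsupp.degree (m - Finsupp.single i 1) (Finsupp.single i 1)
      rw [tsub_add_cancel_of_le (Finsupp.single_le_iff.2 hi), Finsupp.degree_single] at h
      omega

theorem sum_lowering_pow_eq_zero (n : σ → ℕ) (p : MvPolynomial σ R) :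
    ((∑ i, lowering R n i) ^ (p.totalDegree + 1)) p = 0 := by
  nth_rw 2 [p.as_sum]
  rw [map_sum]
  exact Finset.sum_eq_zero fun m hm =>
    sum_lowering_pow_monomial n (Nat.lt_succ_of_le (le_totalDegree hm)) _

end PurePower

section Lefschetz

open MvPolynomial

variable {K σ : Type*} [Field K] [CharZero K] [Fintype σ]

theorem mem_purePowerIdeal_of_sum_X_pow_mul_mem {n : σ → ℕ} {k s : ℕ}
    (hks : s + 2 * k + Fintype.card σ ≤ ∑ i, n i) {p : MvPolynomial σ K} (hp : p.IsHomogeneous k)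
    (h : (∑ i, X i) ^ s * p ∈ purePowerIdeal K n) : p ∈ purePowerIdeal K n := by
  have hE : ∑ i, LinearMap.mulLeft K (X i : MvPolynomial σ K) = LinearMap.mulLeft K (∑ i, X i) :=
    LinearMap.ext fun q => by simp [Finset.sum_mul]
  refine mem_of_raising_pow_mem (J := (purePowerIdeal K n).restrictScalars K) (s := s)
    (lie_sum_mulLeft_sum_lowering n) (lie_sum_weighing_sum_mulLeft n)
    (lie_sum_weighing_sum_lowering n) (fun q hq => ?_) (fun q hq => ?_)
    (fun q => ⟨_, sum_lowering_pow_eq_zero n q⟩) ?_ (sum_weighing_apply n hp) ?_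
  · rw [hE]
    exact Ideal.mul_mem_left _ _ hq
  · rw [Submodule.mem_comap, LinearMap.sum_apply]
    exact Submodule.sum_mem _ fun i _ => lowering_mem_purePowerIdeal n i hq
  · zify at hks
    linarith
  · rw [hE, LinearMap.pow_mulLeft]
    exact h

end Lefschetz

section PolynomialMatrix

open Polynomial

variable {K m n : Type*} [Field K] [Fintype n]

theorem exists_mul_eq_one_of_mulVec_injective [Fintype m] [DecidableEq n] {M : Matrix m n K}
    (hM : Function.Injective M.mulVec) : ∃ G : Matrix n m K, G * M = 1 := by
  classical
  obtain ⟨G, hG⟩ := M.mulVecLin.exists_leftInverse_of_injective (LinearMap.ker_eq_bot.2 hM)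
  refine ⟨LinearMap.toMatrix' G, ?_⟩
  rw [← LinearMap.toMatrix'_toLin' M, ← LinearMap.toMatrix'_comp, Matrix.toLin'_apply', hG,
    LinearMap.toMatrix'_id]

theorem finite_setOf_not_mulVec_injective_eval [Finite m] {M : Matrix m n K[X]} {a : K}
    (ha : Function.Injective (M.map (eval a)).mulVec) :
    {c : K | ¬ Function.Injective (M.map (eval c)).mulVec}.Finite := by
  classical
  cases nonempty_fintype m
  obtain ⟨G, hG⟩ := exists_mul_eq_one_of_mulVec_injective ha
  set P : K[X] := (G.map C * M).det
  have hP (c : K) : P.eval c = (G * M.map (eval c)).det := by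
    rw [← coe_evalRingHom, RingHom.map_det]
    congr 1
    ext i j
    simp [Matrix.mul_apply, eval_finsetSum]
  have hP0 : P ≠ 0 := fun h => by simpa [h, hG] using hP a
  refine P.roots.toFinset.finite_toSet.subset fun c hc => ?_
  rw [Finset.mem_coe, Multiset.mem_toFinset, mem_roots hP0, IsRoot.def]
  by_contra hne
  refine hc (Function.Injective.of_comp (f := G.mulVec) ?_)
  have hcomp : G.mulVec ∘ (M.map (eval c)).mulVec = (G * M.map (eval c)).mulVec :=
    funext fun v => Matrix.mulVec_mulVec v G _
  rw [hcomp]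
  exact Matrix.mulVec_injective_of_det_ne_zero (hP c ▸ hne)

end PolynomialMatrix

section Evaluation

variable {σ R B : Type*} [CommRing R] [CommRing B] [Algebra R B]

theorem aeval_monomial_eq_smul_prod [Fintype σ] (y : σ → B) (m : σ →₀ ℕ) (a : R) :
    MvPolynomial.aeval y (MvPolynomial.monomial m a) = a • ∏ i, y i ^ m i := by
  rw [MvPolynomial.aeval_monomial, Finsupp.prod_fintype _ _ fun _ => pow_zero _, Algebra.smul_def]

theorem aeval_mk_X (I : Ideal (MvPolynomial σ R)) (p : MvPolynomial σ R) :
    MvPolynomial.aeval (fun i => Ideal.Quotient.mk I (MvPolynomial.X i)) p =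
      Ideal.Quotient.mk I p :=
  (MvPolynomial.comp_aeval_apply MvPolynomial.X (Ideal.Quotient.mkₐ R I) p).symm.trans
    (congrArg _ (MvPolynomial.aeval_X_left_apply p))

end Evaluation

/-- The exponents of the monomials outside the initial ideal
`(x₀^d₀, x₁^d₁, x₂^d₂) + x₀^(d₀-α₀) (x₁^(d₁-α₁), x₂^(d₂-α₂))` of `binomialIdeal K c d α`. -/
def normalExponents (d α : Fin 3 → ℕ) : Finset (Fin 3 → ℕ) :=
  {b ∈ Fintype.piFinset fun i => Finset.range (d i) |
    b 0 < d 0 - α 0 ∨ b 1 < d 1 - α 1 ∧ b 2 < d 2 - α 2}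

theorem mem_normalExponents {d α b : Fin 3 → ℕ} : b ∈ normalExponents d α ↔
    (∀ i, b i < d i) ∧ (b 0 < d 0 - α 0 ∨ b 1 < d 1 - α 1 ∧ b 2 < d 2 - α 2) := by
  simp [normalExponents]

theorem notMem_normalExponents {d α b : Fin 3 → ℕ} : b ∉ normalExponents d α ↔
    d 1 ≤ b 1 ∨ d 2 ≤ b 2 ∨ d 0 ≤ b 0 ∨
      d 0 - α 0 ≤ b 0 ∧ (d 1 - α 1 ≤ b 1 ∨ d 2 - α 2 ≤ b 2) := by
  rw [mem_normalExponents, Fin.forall_fin_succ, Fin.forall_fin_two]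
  simp only [Fin.succ_zero_eq_one, Fin.succ_one_eq_two]
  omega

/-- The elements of `normalExponents d α` of degree `k`. -/
def normalExponentsOfDegree (d α : Fin 3 → ℕ) (k : ℕ) : Finset (Fin 3 → ℕ) :=
  {b ∈ normalExponents d α | ∑ i, b i = k}

theorem mem_normalExponentsOfDegree {d α b : Fin 3 → ℕ} {k : ℕ} :
    b ∈ normalExponentsOfDegree d α k ↔ b ∈ normalExponents d α ∧ ∑ i, b i = k := by
  simp [normalExponentsOfDegree]

/-- The exponent of the monomial obtained from `x ^ b` by replacing `x₀ ^ d₀` by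
`x₁ ^ α₁ x₂ ^ α₂` as often as possible. -/
def reducedExponent (d α b : Fin 3 → ℕ) : Fin 3 → ℕ :=
  ![b 0 % d 0, b 1 + b 0 / d 0 * α 1, b 2 + b 0 / d 0 * α 2]

theorem sum_reducedExponent {d α : Fin 3 → ℕ} (hd : d 0 = α 1 + α 2) (b : Fin 3 → ℕ) :
    ∑ i, reducedExponent d α b i = ∑ i, b i := by
  have h := Nat.mod_add_div (b 0) (d 0)
  have h' : d 0 * (b 0 / d 0) = b 0 / d 0 * α 1 + b 0 / d 0 * α 2 := by rw [hd]; ring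
  simp only [Fin.sum_univ_three, reducedExponent, Matrix.cons_val]
  omega

/-- The relations of `binomialIdeal R (-c) d α` for three elements of a commutative algebra. -/
structure BinomialRelations {R B : Type*} [CommRing R] [CommRing B] [Algebra R B] (c : R)
    (d α : Fin 3 → ℕ) (y : Fin 3 → B) : Prop where
  binomial : y 0 ^ d 0 = c • (y 1 ^ α 1 * y 2 ^ α 2)
  pow_one : y 1 ^ d 1 = 0
  pow_two : y 2 ^ d 2 = 0
  mul_one : y 0 ^ (d 0 - α 0) * y 1 ^ (d 1 - α 1) = 0
  mul_two : y 0 ^ (d 0 - α 0) * y 2 ^ (d 2 - α 2) = 0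

/-- The coefficient of the normal monomial `x ^ b` in the normal form of `p` modulo
`binomialIdeal R (-c) d α`, as a polynomial in `c`. -/
def normalCoeff {R : Type*} [CommRing R] (d α : Fin 3 → ℕ) (p : MvPolynomial (Fin 3) R)
    (b : Fin 3 → ℕ) : Polynomial R :=
  ∑ m ∈ p.support.filter fun m : Fin 3 →₀ ℕ => reducedExponent d α m = b,
    Polynomial.monomial (m 0 / d 0) (p.coeff m)

theorem prod_pow_eq_zero_of_le {ι B : Type*} [Fintype ι] [CommMonoidWithZero B] {y : ι → B}
    {b b' : ι → ℕ} (h : b ≤ b') (hb : ∏ i, y i ^ b i = 0) : ∏ i, y i ^ b' i = 0 :=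
  zero_dvd_iff.1 (hb ▸ Finset.prod_dvd_prod_of_dvd _ _ fun i _ => pow_dvd_pow (y i) (h i))

namespace BinomialRelations

variable {R B : Type*} [CommRing R] [CommRing B] [Algebra R B] {c : R} {d α : Fin 3 → ℕ}
  {y : Fin 3 → B}

theorem prod_pow_eq_smul (hy : BinomialRelations c d α y) (b : Fin 3 → ℕ) :
    ∏ i, y i ^ b i = c ^ (b 0 / d 0) • ∏ i, y i ^ reducedExponent d α b i := by
  have h0 : y 0 ^ b 0 = y 0 ^ (b 0 % d 0) * (y 0 ^ d 0) ^ (b 0 / d 0) := by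
    rw [← pow_mul, ← pow_add, Nat.mod_add_div]
  rw [Fin.prod_univ_three, h0, hy.binomial, smul_pow]
  simp only [Fin.prod_univ_three, reducedExponent, Matrix.cons_val, Algebra.smul_def]
  ring

theorem prod_pow_eq_zero (hy : BinomialRelations c d α y) {b : Fin 3 → ℕ} (hb0 : b 0 < d 0)
    (hb : b ∉ normalExponents d α) : ∏ i, y i ^ b i = 0 := by
  rw [Fin.prod_univ_three]
  have mul_pow_eq_zero {k l k' l' : ℕ} {u v : B} (h : u ^ k * v ^ l = 0) (hk : k ≤ k')
      (hl : l ≤ l') : u ^ k' * v ^ l' = 0 :=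
    zero_dvd_iff.1 (h ▸ mul_dvd_mul (pow_dvd_pow u hk) (pow_dvd_pow v hl))
  rcases notMem_normalExponents.1 hb with h1 | h2 | h0 | ⟨h0, h1 | h2⟩
  · rw [pow_eq_zero_of_le h1 hy.pow_one, mul_zero, zero_mul]
  · rw [pow_eq_zero_of_le h2 hy.pow_two, mul_zero]
  · exact absurd hb0 h0.not_gt
  · rw [mul_pow_eq_zero hy.mul_one h0 h1, zero_mul]
  · rw [mul_right_comm, mul_pow_eq_zero hy.mul_two h0 h2, zero_mul]

theorem aeval_eq_sum (hy : BinomialRelations c d α y) (h0 : 0 < d 0) (p : MvPolynomial (Fin 3) R) :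
    MvPolynomial.aeval y p =
      ∑ b ∈ normalExponents d α, (normalCoeff d α p b).eval c • ∏ i, y i ^ b i := by
  have sum_ite_mem (m : Fin 3 → ℕ) :
      (∑ b ∈ normalExponents d α, if reducedExponent d α m = b then ∏ i, y i ^ b i else 0) =
        ∏ i, y i ^ reducedExponent d α m i := by
    rw [Finset.sum_ite_eq, ite_eq_left_iff]
    exact fun hm => (hy.prod_pow_eq_zero (Nat.mod_lt _ h0) hm).symm
  simp only [MvPolynomial.aeval_def, MvPolynomial.eval₂_eq', normalCoeff,
    Polynomial.eval_finsetSum, Finset.sum_smul, Polynomial.eval_monomial]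
  simp_rw [Finset.sum_filter]
  rw [Finset.sum_comm]
  refine Finset.sum_congr rfl fun m _ => ?_
  rw [hy.prod_pow_eq_smul m, ← sum_ite_mem, ← Algebra.smul_def, smul_smul, Finset.smul_sum]
  simp only [smul_ite, smul_zero]

theorem aeval_eq_sum_of_isHomogeneous (hy : BinomialRelations c d α y) (h0 : 0 < d 0)
    (hd : d 0 = α 1 + α 2) {k : ℕ} {p : MvPolynomial (Fin 3) R} (hp : p.IsHomogeneous k) :
    MvPolynomial.aeval y p =
      ∑ b ∈ normalExponentsOfDegree d α k, (normalCoeff d α p b).eval c • ∏ i, y i ^ b i := by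
  rw [hy.aeval_eq_sum h0, normalExponentsOfDegree, Finset.sum_filter_of_ne]
  intro b _ hb
  by_contra hbk
  refine hb ?_
  rw [normalCoeff, Finset.filter_false_of_mem, Finset.sum_empty, Polynomial.eval_zero, zero_smul]
  rintro m hm rfl
  rw [sum_reducedExponent hd, ← Finsupp.degree_eq_sum] at hbk
  exact MvPolynomial.mem_support_iff.1 hm (hp.coeff_eq_zero hbk)

end BinomialRelations

section InitialIdeal

open MvPolynomial

variable {R K : Type*} [CommRing R] [Field K] {d α : Fin 3 → ℕ}

theorem normalExponents_of_le {b b' : Fin 3 → ℕ} (h : b ≤ b') (hb' : b' ∈ normalExponents d α) :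
    b ∈ normalExponents d α := by
  rw [mem_normalExponents] at hb' ⊢
  refine ⟨fun i => (h i).trans_lt (hb'.1 i), ?_⟩
  have h0 : b 0 ≤ b' 0 := h 0
  have h1 : b 1 ≤ b' 1 := h 1
  have h2 : b 2 ≤ b' 2 := h 2
  omega

/-- The ideal spanned by the monomials whose exponents do not belong to `normalExponents d α`,
to which `binomialIdeal R c d α` degenerates. -/
def initialIdeal (R : Type*) [CommRing R] (d α : Fin 3 → ℕ) : Ideal (MvPolynomial (Fin 3) R) :=
  Ideal.span ((fun m => monomial m 1) '' {m : Fin 3 →₀ ℕ | ⇑m ∉ normalExponents d α})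

theorem mem_initialIdeal {p : MvPolynomial (Fin 3) R} :
    p ∈ initialIdeal R d α ↔ ∀ m ∈ p.support, ⇑m ∉ normalExponents d α := by
  rw [initialIdeal, mem_ideal_span_monomial_image]
  refine forall₂_congr fun m _ => ⟨?_, fun hm => ⟨m, hm, le_rfl⟩⟩
  rintro ⟨m', hm', hle⟩ hm
  exact hm' (normalExponents_of_le hle hm)

theorem monomial_mem_initialIdeal {m : Fin 3 →₀ ℕ} (hm : ⇑m ∉ normalExponents d α) :
    monomial m 1 ∈ initialIdeal R d α :=
  Ideal.subset_span ⟨m, hm, rfl⟩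

theorem monomial_single_mul_mem_initialIdeal (h0 : α 0 ≤ d 0) {p : MvPolynomial (Fin 3) R} :
    monomial (Finsupp.single 0 (d 0 - α 0)) 1 * p ∈ initialIdeal R d α ↔
      p ∈ purePowerIdeal R ![α 0, d 1 - α 1, d 2 - α 2] := by
  set e : Fin 3 →₀ ℕ := Finsupp.single 0 (d 0 - α 0) with he
  have normal_iff (m : Fin 3 →₀ ℕ) :
      ⇑(e + m) ∉ normalExponents d α ↔ ∃ i, ![α 0, d 1 - α 1, d 2 - α 2] i ≤ m i := by
    simp only [he, notMem_normalExponents, Fin.exists_fin_succ, Fin.succ_zero_eq_one,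
      Fin.succ_one_eq_two, IsEmpty.exists_iff, or_false, Matrix.cons_val_zero, Matrix.cons_val_succ,
      Matrix.cons_val_fin_one, Finsupp.coe_add, Pi.add_apply, Finsupp.single_eq_same, ne_eq,
      one_ne_zero, not_false_eq_true, Finsupp.single_eq_of_ne, zero_add, Fin.reduceEq]
    omega
  rw [mem_initialIdeal, mem_purePowerIdeal]
  refine ⟨fun h m hm => (normal_iff m).1 (h _ ?_), fun h m hm => ?_⟩
  · rwa [mem_support_iff, coeff_monomial_mul, one_mul, ← mem_support_iff]
  · rw [mem_support_iff, coeff_monomial_mul', ite_ne_right_iff, one_mul] at hm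
    rw [← add_tsub_cancel_of_le hm.1, normal_iff]
    exact h _ (mem_support_iff.2 hm.2)

theorem initialIdeal_le_purePowerIdeal :
    initialIdeal R d α ≤ purePowerIdeal R ![d 0 - α 0, d 1, d 2] := fun p hp =>
  mem_purePowerIdeal.2 fun m hm => by
    have := notMem_normalExponents.1 (mem_initialIdeal.1 hp m hm)
    simp only [Fin.exists_fin_succ, Fin.succ_zero_eq_one, Fin.succ_one_eq_two, IsEmpty.exists_iff,
      or_false, Matrix.cons_val_zero, Matrix.cons_val_succ, Matrix.cons_val_fin_one]
    omega

theorem modMonomial_mem_initialIdeal {p : MvPolynomial (Fin 3) R}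
    (hp : p ∈ purePowerIdeal R ![d 0 - α 0, d 1, d 2]) :
    p.modMonomial (Finsupp.single 0 (d 0 - α 0)) ∈ initialIdeal R d α := by
  refine mem_initialIdeal.2 fun m hm => notMem_normalExponents.2 ?_
  have hle : ¬ Finsupp.single 0 (d 0 - α 0) ≤ m := fun hle =>
    mem_support_iff.1 hm (coeff_modMonomial_of_le p hle)
  rw [mem_support_iff, coeff_modMonomial_of_not_le p hle, ← mem_support_iff] at hm
  have := mem_purePowerIdeal.1 hp m hm
  simp only [Fin.exists_fin_succ, Fin.succ_zero_eq_one, Fin.succ_one_eq_two, IsEmpty.exists_iff,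
    or_false, Matrix.cons_val_zero, Matrix.cons_val_succ, Matrix.cons_val_fin_one,
    Finsupp.single_le_iff, not_le] at this hle
  omega

theorem divMonomial_eq_zero_or_isHomogeneous {σ : Type*} {p : MvPolynomial σ R} {k : ℕ}
    (hp : p.IsHomogeneous k) (e : σ →₀ ℕ) :
    p.divMonomial e = 0 ∨ ∃ j, e.degree + j = k ∧ (p.divMonomial e).IsHomogeneous j := by
  have hdeg (m : σ →₀ ℕ) (hm : coeff m (p.divMonomial e) ≠ 0) : e.degree + m.degree = k := by
    by_contra hne
    rw [← map_add] at hne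
    exact hm (hp.coeff_eq_zero hne)
  obtain h | ⟨m₀, hm₀⟩ := (p.divMonomial e).support.eq_empty_or_nonempty
  · exact .inl (support_eq_empty.1 h)
  have hm₀ := hdeg m₀ (mem_support_iff.1 hm₀)
  refine .inr ⟨m₀.degree, hm₀, fun m hm => ?_⟩
  exact (DFunLike.congr_fun Finsupp.degree_eq_weight_one m).symm.trans
    (Nat.add_left_cancel ((hdeg m hm).trans hm₀.symm))

theorem mem_initialIdeal_of_sum_X_pow_mul_mem [CharZero K] (hα : α ≤ d) (hd : d 0 = α 1 + α 2)
    {k s : ℕ} (hks : s + 2 * k + 3 ≤ d 0 - α 0 + d 1 + d 2) {p : MvPolynomial (Fin 3) K}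
    (hp : p.IsHomogeneous k) (h : (∑ i, X i) ^ s * p ∈ initialIdeal K d α) :
    p ∈ initialIdeal K d α := by
  set e : Fin 3 →₀ ℕ := Finsupp.single 0 (d 0 - α 0) with he
  have hp_pure : p ∈ purePowerIdeal K ![d 0 - α 0, d 1, d 2] :=
    mem_purePowerIdeal_of_sum_X_pow_mul_mem (by simpa [Fin.sum_univ_three] using hks) hp
      (initialIdeal_le_purePowerIdeal h)
  have hmod : p.modMonomial e ∈ initialIdeal K d α := modMonomial_mem_initialIdeal hp_pure
  rw [← divMonomial_add_modMonomial p e] at h ⊢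
  rw [mul_add, Ideal.add_mem_iff_left _ (Ideal.mul_mem_left _ _ hmod), mul_left_comm,
    monomial_single_mul_mem_initialIdeal (hα 0)] at h
  refine Ideal.add_mem _ ((monomial_single_mul_mem_initialIdeal (hα 0)).2 ?_) hmod
  obtain hq | ⟨j, hj, hq⟩ := divMonomial_eq_zero_or_isHomogeneous hp e
  · rw [hq]
    exact Ideal.zero_mem _
  refine mem_purePowerIdeal_of_sum_X_pow_mul_mem ?_ hq h
  rw [he, Finsupp.degree_single] at hj
  have h0 : α 0 ≤ d 0 := hα 0
  have h1 : α 1 ≤ d 1 := hα 1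
  have h2 : α 2 ≤ d 2 := hα 2
  simp only [Fintype.card_fin, Fin.sum_univ_three, Matrix.cons_val]
  omega

theorem binomialRelations_initialIdeal :
    BinomialRelations (0 : R) d α fun i => Ideal.Quotient.mk (initialIdeal R d α) (X i) := by
  have prod_eq_zero (b : Fin 3 → ℕ) (hb : b ∉ normalExponents d α) :
      ∏ i, Ideal.Quotient.mk (initialIdeal R d α) (X i) ^ b i = 0 := by
    simpa [aeval_monomial_eq_smul_prod] using (aeval_mk_X (initialIdeal R d α) _).trans
      (Ideal.Quotient.eq_zero_iff_mem.2
        (monomial_mem_initialIdeal (m := Finsupp.equivFunOnFinite.symm b) hb))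
  simp only [Fin.prod_univ_three, notMem_normalExponents] at prod_eq_zero
  constructor
  · simpa using prod_eq_zero ![d 0, 0, 0]
  · simpa using prod_eq_zero ![0, d 1, 0]
  · simpa using prod_eq_zero ![0, 0, d 2]
  · simpa using prod_eq_zero ![d 0 - α 0, d 1 - α 1, 0]
  · simpa using prod_eq_zero ![d 0 - α 0, 0, d 2 - α 2]

end InitialIdeal

section ExistsAlgEquiv

open MvPolynomial

variable {K A : Type*} [Field K] [CommRing A] [Algebra K A] {c : K} {d α : Fin 3 → ℕ}
  {y : Fin 3 → A} {𝒜 : ℕ → Submodule K A}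

/-- The elements `y` of degree one generate the graded pieces `𝒜` of an algebra subject to precisely
the relations of `binomialIdeal K (-c) d α`: the normal monomials are linearly independent. -/
structure BinomialGrading (𝒜 : ℕ → Submodule K A) (c : K) (d α : Fin 3 → ℕ) (y : Fin 3 → A) : Prop
    extends BinomialRelations c d α y where
  pos : ∀ i, 0 < d i
  lt : α 0 < d 0
  le : α ≤ d
  degree_eq : d 0 = α 1 + α 2
  grading : ∀ k, 𝒜 k = (homogeneousSubmodule (Fin 3) K k).map (aeval y).toLinearMap
  linearIndependent : LinearIndependent K fun b : normalExponents d α => ∏ i, y i ^ b.1 i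

theorem binomialRelations_binomialIdeal : BinomialRelations c d α fun i =>
    Ideal.Quotient.mk (binomialIdeal K (-c) d α) (X i) := by
  constructor
  · rw [← sub_eq_zero, Algebra.smul_def, ← Ideal.Quotient.mk_algebraMap]
    simp only [← map_pow, ← map_mul, ← map_sub]
    refine Ideal.Quotient.eq_zero_iff_mem.2 (Ideal.subset_span (.inl ?_))
    simp [sub_eq_add_neg, algebraMap_eq]
  all_goals
    simp only [← map_pow, ← map_mul]
    exact Ideal.Quotient.eq_zero_iff_mem.2 (Ideal.subset_span (by simp))

theorem BinomialRelations.binomialIdeal_le_ker (hy : BinomialRelations c d α y) :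
    binomialIdeal K (-c) d α ≤ RingHom.ker (aeval (R := K) y) := by
  refine Ideal.span_le.2 ?_
  rintro p (rfl | rfl | rfl | rfl | rfl) <;>
    simp [RingHom.mem_ker, hy.binomial, hy.pow_one, hy.pow_two, hy.mul_one, hy.mul_two,
      Algebra.smul_def]

theorem BinomialRelations.ker_aeval (hy : BinomialRelations c d α y) (h0 : 0 < d 0)
    (hli : LinearIndependent K fun b : normalExponents d α => ∏ i, y i ^ b.1 i) :
    RingHom.ker (aeval (R := K) y) = binomialIdeal K (-c) d α := by
  refine le_antisymm (fun p hp => ?_) hy.binomialIdeal_le_ker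
  rw [RingHom.mem_ker, hy.aeval_eq_sum h0, ← Finset.sum_coe_sort] at hp
  have hcoeff := Fintype.linearIndependent_iff.1 hli _ hp
  rw [← Ideal.Quotient.eq_zero_iff_mem, ← aeval_mk_X,
    binomialRelations_binomialIdeal.aeval_eq_sum h0]
  exact Finset.sum_eq_zero fun b hb => by rw [hcoeff ⟨b, hb⟩, zero_smul]

theorem BinomialGrading.exists_algEquiv (h : BinomialGrading 𝒜 c d α y)
    (hsurj : Function.Surjective (aeval (R := K) y)) :
    ∃ e : A ≃ₐ[K] (MvPolynomial (Fin 3) K ⧸ binomialIdeal K (-c) d α),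
      ∀ i, (𝒜 i).map e.toLinearMap = quotientGrading (binomialIdeal K (-c) d α) i := by
  let e := (Ideal.quotientKerAlgEquivOfSurjective hsurj).symm.trans
    (Ideal.quotientEquivAlgOfEq K (h.ker_aeval (h.pos 0) h.linearIndependent))
  have he (p : MvPolynomial (Fin 3) K) :
      e (aeval y p) = Ideal.Quotient.mkₐ K (binomialIdeal K (-c) d α) p := by
    have hp : (Ideal.quotientKerAlgEquivOfSurjective hsurj).symm (aeval y p) =
        Ideal.Quotient.mk _ p := (AlgEquiv.symm_apply_eq _).2 rfl
    rw [AlgEquiv.trans_apply, hp]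
    rfl
  refine ⟨e, fun i => ?_⟩
  rw [h.grading, quotientGrading, ← Submodule.map_comp]
  exact congrArg (Submodule.map · _) (LinearMap.ext he)

end ExistsAlgEquiv

section Lefschetz

open Module

variable {K A : Type*} [Field K] [CommRing A] [Algebra K A] {𝒜 : ℕ → Submodule K A}

theorem hasSLP_of_injOn [SetLike.GradedMonoid 𝒜] [∀ k, FiniteDimensional K (𝒜 k)] {N : ℕ}
    (hsymm : ∀ k l, k + l = N → finrank K (𝒜 k) = finrank K (𝒜 l))
    (hbot : ∀ k, N < k → 𝒜 k = ⊥) {ℓ : A} (hℓ : ℓ ∈ 𝒜 1)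
    (hinj : ∀ k s, s + 2 * k ≤ N → Set.InjOn (fun a => ℓ ^ s * a) (𝒜 k : Set A)) :
    HasSLP 𝒜 := by
  have pow_mul_mem {k s : ℕ} {a : A} (ha : a ∈ 𝒜 k) : ℓ ^ s * a ∈ 𝒜 (k + s) := by
    have := SetLike.mul_mem_graded (SetLike.pow_mem_graded s hℓ) ha
    rwa [smul_eq_mul, mul_one, add_comm] at this
  refine ⟨ℓ, hℓ, fun k s => ?_⟩
  obtain hks | hks := le_or_gt (s + 2 * k) N
  · exact .inl (hinj k s hks)
  refine .inr fun z hz => ?_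
  obtain hN | hN := lt_or_ge N (k + s)
  · rw [SetLike.mem_coe, hbot _ hN, Submodule.mem_bot] at hz
    exact ⟨0, zero_mem _, by simp [hz]⟩
  -- the degree `k'` reflecting `k + s` is at most `k`; `ℓ ^ (r + s)` maps it onto degree `k + s`
  obtain ⟨k', hk'⟩ := Nat.exists_eq_add_of_le hN
  obtain ⟨r, rfl⟩ : ∃ r, k = k' + r := Nat.exists_eq_add_of_le (by omega)
  let f : 𝒜 k' →ₗ[K] 𝒜 (k' + (r + s)) :=
    (LinearMap.mulLeft K (ℓ ^ (r + s))).restrict fun a ha => pow_mul_mem ha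
  have hf : Function.Injective f := fun a a' h =>
    Subtype.ext (hinj k' (r + s) (by omega) a.2 a'.2 (congrArg Subtype.val h))
  have hrank : finrank K (𝒜 k') = finrank K (𝒜 (k' + (r + s))) := hsymm _ _ (by omega)
  obtain ⟨x, hx⟩ :=
    (LinearMap.injective_iff_surjective_of_finrank_eq_finrank hrank).1 hf ⟨z, by rwa [← add_assoc]⟩
  refine ⟨ℓ ^ r * x, pow_mul_mem x.2, ?_⟩
  change ℓ ^ s * (ℓ ^ r * (x : A)) = z
  rw [← mul_assoc, ← pow_add, add_comm s r]
  exact congrArg Subtype.val hx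

end Lefschetz

section HilbertFunction

variable {d α : Fin 3 → ℕ}

/-- The involution of the normal exponents that reflects their degrees: the normal exponents form
the box below `(d₀ - α₀, d₁, d₂)` and a translate of the box below `(α₀, d₁ - α₁, d₂ - α₂)`, and
each is reflected separately. -/
def reflectedExponent (d α b : Fin 3 → ℕ) : Fin 3 → ℕ :=
  if b 0 < d 0 - α 0 then ![d 0 - α 0 - 1 - b 0, d 1 - 1 - b 1, d 2 - 1 - b 2]
  else ![d 0 - α 0 + (d 0 - 1 - b 0), d 1 - α 1 - 1 - b 1, d 2 - α 2 - 1 - b 2]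

theorem reflectedExponent_mem {b : Fin 3 → ℕ} {k l : ℕ} (hα : α ≤ d) (hd : d 0 = α 1 + α 2)
    (hkl : k + l + 3 = d 0 - α 0 + d 1 + d 2) (hb : b ∈ normalExponentsOfDegree d α k) :
    reflectedExponent d α b ∈ normalExponentsOfDegree d α l := by
  have := hα 0
  have := hα 1
  have := hα 2
  simp only [mem_normalExponentsOfDegree, mem_normalExponents, Fin.forall_fin_succ,
    Fin.sum_univ_three, reflectedExponent, Fin.succ_zero_eq_one, Fin.succ_one_eq_two,
    IsEmpty.forall_iff, and_true] at hb ⊢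
  split_ifs <;> simp only [Matrix.cons_val] <;> omega

theorem reflectedExponent_reflectedExponent {b : Fin 3 → ℕ} (hα : α 0 ≤ d 0)
    (hb : b ∈ normalExponents d α) : reflectedExponent d α (reflectedExponent d α b) = b := by
  rw [mem_normalExponents] at hb
  have h0 := hb.1 0
  have h1 := hb.1 1
  have h2 := hb.1 2
  ext i
  by_cases h : b 0 < d 0 - α 0
  · have h' : d 0 - α 0 - 1 - b 0 < d 0 - α 0 := by omega
    simp only [reflectedExponent, h, h', ↓reduceIte, Matrix.cons_val]
    fin_cases i <;> simp only [Fin.zero_eta, Fin.mk_one, Fin.reduceFinMk, Matrix.cons_val] <;> omega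
  · simp only [reflectedExponent, h, ↓reduceIte, Matrix.cons_val, add_lt_iff_neg_left, not_lt_zero]
    fin_cases i <;> simp only [Fin.zero_eta, Fin.mk_one, Fin.reduceFinMk, Matrix.cons_val] <;> omega

theorem card_normalExponentsOfDegree {k l : ℕ} (hα : α ≤ d) (hd : d 0 = α 1 + α 2)
    (hkl : k + l + 3 = d 0 - α 0 + d 1 + d 2) :
    (normalExponentsOfDegree d α k).card = (normalExponentsOfDegree d α l).card := by
  have hmem {k : ℕ} {b : Fin 3 → ℕ} (hb : b ∈ normalExponentsOfDegree d α k) :=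
    (mem_normalExponentsOfDegree.1 hb).1
  exact Finset.card_nbij' (reflectedExponent d α) (reflectedExponent d α)
    (fun b hb => reflectedExponent_mem hα hd hkl hb)
    (fun b hb => reflectedExponent_mem hα hd (by omega) hb)
    (fun b hb => reflectedExponent_reflectedExponent (hα 0) (hmem hb))
    (fun b hb => reflectedExponent_reflectedExponent (hα 0) (hmem hb))

theorem normalExponentsOfDegree_eq_empty {k : ℕ} (hα : α ≤ d) (hd : d 0 = α 1 + α 2)
    (hk : d 0 - α 0 + d 1 + d 2 < k + 3) : normalExponentsOfDegree d α k = ∅ := by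
  refine Finset.eq_empty_of_forall_notMem fun b hb => ?_
  have := hα 0
  have := hα 1
  have := hα 2
  simp only [mem_normalExponentsOfDegree, mem_normalExponents, Fin.forall_fin_succ,
    Fin.sum_univ_three, Fin.succ_zero_eq_one, Fin.succ_one_eq_two, IsEmpty.forall_iff,
    and_true] at hb
  omega

end HilbertFunction

section LefschetzMatrix

open MvPolynomial Matrix

variable {R B : Type*} [CommRing R] [CommRing B] [Algebra R B] {c : R} {d α : Fin 3 → ℕ}
  {y : Fin 3 → B}

/-- Multiplication by `(x₀ + x₁ + x₂) ^ s` from degree `k` to degree `k + s` modulo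
`binomialIdeal R (-c) d α`, in the bases of normal monomials; the indeterminate stands for `c`. -/
def lefschetzMatrix (R : Type*) [CommRing R] (d α : Fin 3 → ℕ) (k s : ℕ) :
    Matrix (normalExponentsOfDegree d α (k + s)) (normalExponentsOfDegree d α k) (Polynomial R) :=
  .of fun b' b => normalCoeff d α
    ((∑ i, X i) ^ s * monomial (Finsupp.equivFunOnFinite.symm b.1) 1) b'

theorem BinomialRelations.sum_pow_mul_sum (hy : BinomialRelations c d α y) (h0 : 0 < d 0)
    (hd : d 0 = α 1 + α 2) {k s : ℕ} (v : normalExponentsOfDegree d α k → R) :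
    (∑ i, y i) ^ s * ∑ b, v b • ∏ i, y i ^ b.1 i =
      ∑ b', ((lefschetzMatrix R d α k s).map (Polynomial.eval c) *ᵥ v) b' •
        ∏ i, y i ^ b'.1 i := by
  have hcol (b : normalExponentsOfDegree d α k) : (∑ i, y i) ^ s * ∏ i, y i ^ b.1 i =
      ∑ b', (lefschetzMatrix R d α k s b' b).eval c • ∏ i, y i ^ b'.1 i := by
    have hb : (monomial (Finsupp.equivFunOnFinite.symm b.1) (1 : R)).IsHomogeneous k :=
      isHomogeneous_monomial 1 <| by
        rw [Finsupp.degree_eq_sum]; exact (mem_normalExponentsOfDegree.1 b.2).2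
    have hX : (∑ i, X i : MvPolynomial (Fin 3) R).IsHomogeneous 1 :=
      .sum _ _ _ fun i _ => isHomogeneous_X R i
    have hp := (hX.pow s).mul hb
    rw [one_mul, add_comm s k] at hp
    have hsum := hy.aeval_eq_sum_of_isHomogeneous h0 hd hp
    simp only [map_mul, map_pow, map_sum, aeval_X, aeval_monomial_eq_smul_prod, one_smul] at hsum
    exact hsum.trans (Finset.sum_coe_sort _ fun b' => Polynomial.eval c (normalCoeff d α
      ((∑ i, X i) ^ s * monomial (Finsupp.equivFunOnFinite.symm b.1) 1) b') • ∏ i, y i ^ b' i).symm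
  simp only [mulVec, dotProduct, map_apply, Finset.sum_smul, Finset.mul_sum, mul_smul_comm, hcol,
    Finset.smul_sum, smul_smul]
  rw [Finset.sum_comm]
  simp only [mul_comm]

theorem mulVec_lefschetzMatrix_eval_zero_injective {K : Type*} [Field K] [CharZero K] (hα : α ≤ d)
    (h0 : 0 < d 0) (hd : d 0 = α 1 + α 2) {k s : ℕ}
    (hks : s + 2 * k + 3 ≤ d 0 - α 0 + d 1 + d 2) :
    Function.Injective ((lefschetzMatrix K d α k s).map (Polynomial.eval 0)).mulVec := by
  refine (injective_iff_map_eq_zero (Matrix.mulVecLin _)).2 fun v hv => ?_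
  let p : MvPolynomial (Fin 3) K := ∑ b, monomial (Finsupp.equivFunOnFinite.symm b.1) (v b)
  have hp : p.IsHomogeneous k := .sum _ _ _ fun b _ => isHomogeneous_monomial _ <| by
    rw [Finsupp.degree_eq_sum]; exact (mem_normalExponentsOfDegree.1 b.2).2
  have hmul := binomialRelations_initialIdeal.sum_pow_mul_sum (R := K) (s := s) h0 hd v
  rw [← mulVecLin_apply, hv] at hmul
  have hmem : (∑ i, X i) ^ s * p ∈ initialIdeal K d α := by
    rw [← Ideal.Quotient.eq_zero_iff_mem, ← aeval_mk_X]
    simpa [p, aeval_monomial_eq_smul_prod] using hmul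
  funext b
  by_contra hb
  refine mem_initialIdeal.1 (mem_initialIdeal_of_sum_X_pow_mul_mem hα hd hks hp hmem)
    (Finsupp.equivFunOnFinite.symm b.1) ?_ (mem_normalExponentsOfDegree.1 b.2).1
  rwa [mem_support_iff, coeff_sum, Finset.sum_congr rfl fun b' _ => coeff_monomial _ _ _,
    Finset.sum_eq_single b (fun b' _ hb' => if_neg fun h => hb' (Subtype.ext
      (Finsupp.equivFunOnFinite.symm.injective h))) (by simp), if_pos rfl]

theorem exists_unit_mulVec_lefschetzMatrix_injective {K : Type*} [Field K] [CharZero K] (c : K)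
    (hα : α ≤ d) (h0 : 0 < d 0) (hd : d 0 = α 1 + α 2) :
    ∃ l : Kˣ, ∀ k s, s + 2 * k + 3 ≤ d 0 - α 0 + d 1 + d 2 →
      Function.Injective
        ((lefschetzMatrix K d α k s).map (Polynomial.eval (c * (l : K) ^ d 0))).mulVec := by
  have injective_zero := @mulVec_lefschetzMatrix_eval_zero_injective d α K _ _ hα h0 hd
  obtain rfl | hc := eq_or_ne c 0
  · exact ⟨1, fun k s hks => by rw [zero_mul]; exact injective_zero hks⟩
  let T := d 0 - α 0 + d 1 + d 2
  let bad : Set K := ⋃ k ∈ Set.Iic T, ⋃ s ∈ Set.Iic T, {a | s + 2 * k + 3 ≤ T ∧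
    ¬ Function.Injective ((lefschetzMatrix K d α k s).map (Polynomial.eval a)).mulVec}
  have hbad : bad.Finite := by
    refine (Set.finite_Iic T).biUnion fun k _ => (Set.finite_Iic T).biUnion fun s _ => ?_
    by_cases hks : s + 2 * k + 3 ≤ T
    · exact (finite_setOf_not_mulVec_injective_eval (injective_zero hks)).subset fun a ha => ha.2
    · exact Set.finite_empty.subset fun a ha => hks ha.1
  have hinj : Function.Injective fun j : ℕ => c * ((j + 1 : ℕ) : K) ^ d 0 := fun i j hij => by
    have h := mul_left_cancel₀ hc hij
    exact Nat.succ_injective (Nat.pow_left_injective h0.ne' (by exact_mod_cast h))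
  obtain ⟨_, ⟨j, rfl⟩, hj⟩ := (Set.infinite_range_of_injective hinj).exists_notMem_finite hbad
  refine ⟨Units.mk0 ((j + 1 : ℕ) : K) (Nat.cast_ne_zero.2 j.succ_ne_zero), fun k s hks => ?_⟩
  by_contra h
  exact hj (Set.mem_biUnion (Set.mem_Iic.2 (by omega : k ≤ T))
    (Set.mem_biUnion (Set.mem_Iic.2 (by omega : s ≤ T)) ⟨hks, h⟩))

end LefschetzMatrix

section MapAeval

open MvPolynomial

variable {σ K A : Type*} [CommRing K] [CommRing A] [Algebra K A] {𝒜 : ℕ → Submodule K A}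

theorem gradedMonoid_of_eq_map_aeval {y : σ → A}
    (h : ∀ k, 𝒜 k = (homogeneousSubmodule σ K k).map (aeval y).toLinearMap) :
    SetLike.GradedMonoid 𝒜 where
  one_mem := by
    rw [h]
    exact ⟨1, isHomogeneous_one σ K, map_one (aeval y)⟩
  mul_mem k l a b ha hb := by
    rw [h] at ha hb ⊢
    obtain ⟨p, hp, rfl⟩ := ha
    obtain ⟨q, hq, rfl⟩ := hb
    exact ⟨p * q, IsHomogeneous.mul hp hq, map_mul (aeval y) p q⟩

theorem aeval_surjective_of_eq_map_aeval {y : σ → A}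
    (h : ∀ k, 𝒜 k = (homogeneousSubmodule σ K k).map (aeval y).toLinearMap)
    (htop : ⨆ k, 𝒜 k = ⊤) : Function.Surjective (aeval (R := K) y) := by
  have hle (k : ℕ) : 𝒜 k ≤ LinearMap.range (aeval y : MvPolynomial σ K →ₐ[K] A).toLinearMap :=
    (h k).trans_le LinearMap.map_le_range
  exact LinearMap.range_eq_top.1 (eq_top_iff.2 (htop.ge.trans (iSup_le hle)))

theorem map_aeval_units_smul (u : σ → Kˣ) (y : σ → A) (k : ℕ) :
    (homogeneousSubmodule σ K k).map (aeval fun i => u i • y i).toLinearMap =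
      (homogeneousSubmodule σ K k).map (aeval y).toLinearMap := by
  have map_le (u : σ → Kˣ) (y : σ → A) :
      (homogeneousSubmodule σ K k).map (aeval fun i => u i • y i).toLinearMap ≤
        (homogeneousSubmodule σ K k).map (aeval y).toLinearMap := by
    rintro _ ⟨p, hp, rfl⟩
    have hX (i : σ) : (C (u i : K) * X i).IsHomogeneous 1 := isHomogeneous_C_mul_X _ _
    refine ⟨aeval (fun i => C (u i : K) * X i) p, ?_, ?_⟩
    · simpa using IsHomogeneous.aeval hp _ hX
    · simp only [AlgHom.toLinearMap_apply, ← AlgHom.comp_apply, comp_aeval, map_mul,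
        aeval_C, aeval_X, ← Algebra.smul_def, Units.smul_def]
  refine le_antisymm (map_le u y) ?_
  simpa only [inv_smul_smul] using map_le (fun i => (u i)⁻¹) fun i => u i • y i

theorem map_aeval_comp_perm (e : Equiv.Perm σ) (y : σ → A) (k : ℕ) :
    (homogeneousSubmodule σ K k).map (aeval (y ∘ e)).toLinearMap =
      (homogeneousSubmodule σ K k).map (aeval y).toLinearMap := by
  have map_le (e : Equiv.Perm σ) (y : σ → A) :
      (homogeneousSubmodule σ K k).map (aeval (y ∘ e)).toLinearMap ≤
        (homogeneousSubmodule σ K k).map (aeval y).toLinearMap := by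
    rintro _ ⟨p, hp, rfl⟩
    exact ⟨rename e p, IsHomogeneous.rename_isHomogeneous hp, aeval_rename e y p⟩
  refine le_antisymm (map_le e y) ?_
  simpa only [Function.comp_assoc, Equiv.self_comp_symm, Function.comp_id] using
    map_le e.symm (y ∘ e)

end MapAeval

namespace BinomialGrading

open MvPolynomial Module

variable {K A : Type*} [Field K] [CommRing A] [Algebra K A] {c : K} {d α : Fin 3 → ℕ}
  {y : Fin 3 → A} {𝒜 : ℕ → Submodule K A}

theorem smul (h : BinomialGrading 𝒜 c d α y) (l : Kˣ) :
    BinomialGrading 𝒜 (c * (l : K) ^ d 0) d α fun i => (![l, 1, 1] : Fin 3 → Kˣ) i • y i where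
  binomial := by
    simp only [Matrix.cons_val, one_smul, smul_pow, h.binomial, Units.smul_def,
      smul_smul, mul_comm]
  pow_one := by simpa using h.pow_one
  pow_two := by simpa using h.pow_two
  mul_one := by simp [smul_pow, smul_mul_assoc, h.mul_one]
  mul_two := by simp [smul_pow, smul_mul_assoc, h.mul_two]
  pos := h.pos
  lt := h.lt
  le := h.le
  degree_eq := h.degree_eq
  grading k := by rw [map_aeval_units_smul, h.grading]
  linearIndependent := by
    have hli := h.linearIndependent.units_smul fun b => ∏ i, (![l, 1, 1] : Fin 3 → Kˣ) i ^ b.1 i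
    convert hli using 2 with b
    rw [Pi.smul_apply', Units.smul_def, Units.coe_prod, Algebra.smul_def, map_prod,
      ← Finset.prod_mul_distrib]
    simp only [Units.smul_def, Algebra.smul_def, mul_pow, Units.val_pow_eq_pow_val, map_pow]

theorem prod_pow_mem (h : BinomialGrading 𝒜 c d α y) {b : Fin 3 → ℕ} {k : ℕ}
    (hb : ∑ i, b i = k) : ∏ i, y i ^ b i ∈ 𝒜 k := by
  rw [h.grading]
  refine ⟨monomial (Finsupp.equivFunOnFinite.symm b) 1, isHomogeneous_monomial 1 ?_, ?_⟩
  · rwa [Finsupp.degree_eq_sum]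
  · exact (aeval_monomial_eq_smul_prod y _ _).trans (one_smul K _)

theorem mem_one (h : BinomialGrading 𝒜 c d α y) (i : Fin 3) : y i ∈ 𝒜 1 := by
  rw [h.grading]
  exact ⟨X i, isHomogeneous_X K i, aeval_X y i⟩

theorem span_prod_pow (h : BinomialGrading 𝒜 c d α y) (k : ℕ) :
    Submodule.span K (Set.range fun b : normalExponentsOfDegree d α k => ∏ i, y i ^ b.1 i) =
      𝒜 k := by
  refine le_antisymm (Submodule.span_le.2 ?_) ?_
  · rintro _ ⟨b, rfl⟩
    exact h.prod_pow_mem (mem_normalExponentsOfDegree.1 b.2).2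
  · rw [h.grading]
    rintro _ ⟨p, hp, rfl⟩
    rw [AlgHom.toLinearMap_apply, h.aeval_eq_sum_of_isHomogeneous (h.pos 0) h.degree_eq hp]
    exact Submodule.sum_mem _ fun b hb =>
      Submodule.smul_mem _ _ (Submodule.subset_span ⟨⟨b, hb⟩, rfl⟩)

theorem linearIndependent_ofDegree (h : BinomialGrading 𝒜 c d α y) (k : ℕ) :
    LinearIndependent K fun b : normalExponentsOfDegree d α k => ∏ i, y i ^ b.1 i :=
  h.linearIndependent.comp (Set.inclusion (Finset.filter_subset _ _)) (Set.inclusion_injective _)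

theorem finrank_eq_card (h : BinomialGrading 𝒜 c d α y) (k : ℕ) :
    finrank K (𝒜 k) = (normalExponentsOfDegree d α k).card := by
  rw [← h.span_prod_pow, finrank_span_eq_card (h.linearIndependent_ofDegree k), Fintype.card_coe]

theorem injOn_sum_pow_mul (h : BinomialGrading 𝒜 c d α y) {k s : ℕ}
    (hM : Function.Injective ((lefschetzMatrix K d α k s).map (Polynomial.eval c)).mulVec) :
    Set.InjOn (fun a => (∑ i, y i) ^ s * a) (𝒜 k : Set A) := by
  intro a ha a' ha' haa'
  rw [SetLike.mem_coe, ← h.span_prod_pow, Submodule.mem_span_range_iff_exists_fun] at ha ha'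
  obtain ⟨v, rfl⟩ := ha
  obtain ⟨v', rfl⟩ := ha'
  simp only [h.sum_pow_mul_sum (h.pos 0) h.degree_eq] at haa'
  have hli := linearIndependent_iff_injective_fintypeLinearCombination.1
    (h.linearIndependent_ofDegree (k + s))
  rw [hM (hli haa')]

theorem hasSLP [CharZero K] (h : BinomialGrading 𝒜 c d α y) : HasSLP 𝒜 := by
  obtain ⟨l, hl⟩ := exists_unit_mulVec_lefschetzMatrix_injective c h.le (h.pos 0) h.degree_eq
  have := gradedMonoid_of_eq_map_aeval h.grading
  have (k : ℕ) : FiniteDimensional K (𝒜 k) :=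
    h.span_prod_pow k ▸ FiniteDimensional.span_of_finite K (Set.finite_range _)
  have := h.pos 1
  have := h.pos 2
  have := h.lt
  obtain ⟨N, hN⟩ : ∃ N, d 0 - α 0 + d 1 + d 2 = N + 3 := Nat.exists_eq_add_of_le' (by omega)
  refine hasSLP_of_injOn (N := N) (fun k l hkl => ?_) (fun k hk => ?_)
    (sum_mem fun i _ => ?_) fun k s hks => (h.smul l).injOn_sum_pow_mul (hl k s (by omega))
  · rw [h.finrank_eq_card, h.finrank_eq_card,
      card_normalExponentsOfDegree (k := k) (l := l) h.le h.degree_eq (by omega)]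
  · rw [← h.span_prod_pow, normalExponentsOfDegree_eq_empty h.le h.degree_eq (by omega)]
    simp
  · exact (h.smul l).mem_one i

end BinomialGrading

/-- Equality of the degree and of the `g`-weight of two exponent vectors. -/
def EqDegreeWeight {σ : Type*} [Fintype σ] (g b b' : σ → ℕ) : Prop :=
  ∑ i, b i = ∑ i, b' i ∧ ∑ i, b i * g i = ∑ i, b' i * g i

section MonomialGrading

open MvPolynomial

variable {σ K A : Type*} [Fintype σ] [Field K] [CommRing A] [Algebra K A] {𝒜 : ℕ → Submodule K A}
  {g : σ → ℕ} {y : σ → A}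

/-- The elements `y` of degree one generate the graded pieces `𝒜` of an algebra whose only relations
are that some monomials vanish and that monomials of equal degree and `g`-weight agree. -/
structure MonomialGrading (𝒜 : ℕ → Submodule K A) (g : σ → ℕ) (y : σ → A) : Prop where
  grading : ∀ k, 𝒜 k = (homogeneousSubmodule σ K k).map (aeval y).toLinearMap
  prod_pow_eq : ∀ b b', EqDegreeWeight g b b' → ∏ i, y i ^ b i = ∏ i, y i ^ b' i
  linearIndepOn : ∀ s : Set (σ → ℕ), (∀ b ∈ s, ∏ i, y i ^ b i ≠ 0) →
    s.Pairwise (fun b b' => ¬ EqDegreeWeight g b b') →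
    LinearIndepOn K (fun b : σ → ℕ => ∏ i, y i ^ b i) s

theorem prod_pow_mem_gradedSocle
    (hgr : ∀ k, 𝒜 k = (homogeneousSubmodule σ K k).map (aeval y).toLinearMap) {a : σ → ℕ}
    (ha : Maximal (fun b : σ → ℕ => ∏ i, y i ^ b i ≠ 0) a) : ∏ i, y i ^ a i ∈ gradedSocle 𝒜 := by
  intro k hk x hx
  rw [hgr] at hx
  obtain ⟨p, hp, rfl⟩ := hx
  rw [AlgHom.toLinearMap_apply, aeval_def, eval₂_eq', Finset.sum_mul]
  refine Finset.sum_eq_zero fun m hm => ?_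
  rw [mul_assoc, ← Finset.prod_mul_distrib]
  simp only [← pow_add]
  by_contra h
  have hma : ⇑m + a ≤ a := ha.2 (right_ne_zero_of_mul h) le_add_self
  have hm0 : m = 0 := DFunLike.coe_injective (by simpa using hma)
  have hdeg := hp (mem_support_iff.1 hm)
  rw [hm0, map_zero] at hdeg
  exact hk.ne hdeg

theorem MonomialGrading.exists_prod_pow_ne_zero_iff (h : MonomialGrading 𝒜 g y)
    (hfin : {b : σ → ℕ | ∏ i, y i ^ b i ≠ 0}.Finite) (hGor : IsGradedGorenstein 𝒜) :
    ∃ a, ∀ b : σ → ℕ, ∏ i, y i ^ b i ≠ 0 ↔ ∃ a', EqDegreeWeight g a a' ∧ b ≤ a' := by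
  have exists_maximal (b : σ → ℕ) (hb : ∏ i, y i ^ b i ≠ 0) :
      ∃ a, b ≤ a ∧ Maximal (fun b : σ → ℕ => ∏ i, y i ^ b i ≠ 0) a := hfin.exists_le_maximal hb
  have eqDegreeWeight {a a' : σ → ℕ} (ha : Maximal (fun b : σ → ℕ => ∏ i, y i ^ b i ≠ 0) a)
      (ha' : Maximal (fun b : σ → ℕ => ∏ i, y i ^ b i ≠ 0) a') : EqDegreeWeight g a a' := by
    by_contra haa'
    have hne : a ≠ a' := by rintro rfl; exact haa' ⟨rfl, rfl⟩
    have hli := h.linearIndepOn {a, a'} (by simp [ha.1, ha'.1])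
      (Set.pairwise_pair.2 fun _ => ⟨haa', fun h => haa' ⟨h.1.symm, h.2.symm⟩⟩)
    obtain ⟨c, hc⟩ := exists_smul_eq_of_finrank_eq_one hGor
      (x := ⟨_, prod_pow_mem_gradedSocle h.grading ha⟩) (by simpa [Subtype.ext_iff] using ha.1)
      ⟨_, prod_pow_mem_gradedSocle h.grading ha'⟩
    exact (linearIndepOn_pair_iff _ hne ha.1).1 hli c (congrArg Subtype.val hc)
  have : Nontrivial A := by
    have := Module.nontrivial_of_finrank_eq_succ hGor
    exact (Submodule.subtype_injective (gradedSocle 𝒜)).nontrivial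
  obtain ⟨a, -, ha⟩ := exists_maximal 0 (by simp)
  refine ⟨a, fun b => ⟨fun hb => ?_, ?_⟩⟩
  · obtain ⟨a', hba', ha'⟩ := exists_maximal b hb
    exact ⟨a', eqDegreeWeight ha ha', hba'⟩
  · rintro ⟨a', haa', hba'⟩ hb
    exact ha.1 (h.prod_pow_eq _ _ haa' ▸ prod_pow_eq_zero_of_le hba' hb)

end MonomialGrading

section Translation

variable {p q : ℕ}

/-- `b' - b` is an integral multiple of `(p + q, -q, -p)`. -/
def IsTranslate (p q : ℕ) (b b' : Fin 3 → ℕ) : Prop :=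
  ∃ t : ℤ, (b' 0 : ℤ) = b 0 + t * (p + q) ∧ (b' 1 : ℤ) = b 1 - t * q ∧ (b' 2 : ℤ) = b 2 - t * p

/-- `k` divides, as an exponent vector, the translate of `b` by a natural multiple of
`(p + q, -q, -p)`. -/
def IsBelowTranslate (p q : ℕ) (b k : Fin 3 → ℕ) : Prop :=
  ∃ t : ℕ, k 0 ≤ b 0 + t * (p + q) ∧ k 1 + t * q ≤ b 1 ∧ k 2 + t * p ≤ b 2

theorem exists_eqDegreeWeight_iff_isTranslate {g : Fin 3 → ℕ} (h1 : g 1 < g 0) (h2 : g 0 < g 2) :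
    ∃ p q : ℕ, 0 < p ∧ ∀ b b', EqDegreeWeight g b b' ↔ IsTranslate p q b b' := by
  obtain ⟨p, q, hpq, hp, hq⟩ := Nat.exists_coprime (g 0 - g 1) (g 2 - g 0)
  set r := (g 0 - g 1).gcd (g 2 - g 0)
  have hr : 0 < r := Nat.gcd_pos_of_pos_left _ (by omega)
  have hp' : (g 0 : ℤ) = g 1 + p * r := by exact_mod_cast (by omega : g 0 = g 1 + p * r)
  have hq' : (g 2 : ℤ) = g 0 + q * r := by exact_mod_cast (by omega : g 2 = g 0 + q * r)
  have hq0 : (q : ℤ) ≠ 0 := by rintro hq0; rw [hq0] at hq'; omega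
  refine ⟨p, q, Nat.pos_of_ne_zero (by rintro rfl; omega), fun b b' => ?_⟩
  simp only [EqDegreeWeight, IsTranslate, Fin.sum_univ_three]
  zify
  rw [hq', hp']
  constructor
  · rintro ⟨hdeg, hweight⟩
    have hmul : (q : ℤ) * (b 2 - b' 2) = p * (b 1 - b' 1) := by
      refine mul_left_cancel₀ (Int.natCast_ne_zero.2 hr.ne') ?_
      linear_combination hweight - (g 1 + p * r : ℤ) * hdeg
    obtain ⟨t, ht⟩ : (q : ℤ) ∣ b 1 - b' 1 :=
      (Nat.isCoprime_iff_coprime.2 hpq.symm).dvd_of_dvd_mul_left ⟨_, hmul.symm⟩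
    have ht' : (b 2 : ℤ) - b' 2 = p * t := mul_left_cancel₀ hq0 (by rw [hmul, ht]; ring)
    exact ⟨t, by linear_combination -hdeg + ht + ht', by linear_combination -ht,
      by linear_combination -ht'⟩
  · rintro ⟨t, ht0, ht1, ht2⟩
    rw [ht0, ht1, ht2]
    constructor <;> ring

theorem exists_isTranslate_iff_isBelowTranslate (hp : 0 < p) (a : Fin 3 → ℕ) :
    ∃ b : Fin 3 → ℕ, b 0 < p + q ∧
      ∀ k, (∃ a', IsTranslate p q a a' ∧ k ≤ a') ↔ IsBelowTranslate p q b k := by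
  have h0 : (a 0 % (p + q) : ℤ) + (p + q) * (a 0 / (p + q)) = a 0 := Int.emod_add_mul_ediv ..
  have hlt : a 0 % (p + q) < p + q := Nat.mod_lt _ (by omega)
  refine ⟨![a 0 % (p + q), a 1 + a 0 / (p + q) * q, a 2 + a 0 / (p + q) * p], hlt, fun k => ?_⟩
  simp only [IsBelowTranslate, Matrix.cons_val]
  constructor
  · rintro ⟨a', ⟨t, ht0, ht1, ht2⟩, ha'⟩
    have hk0 : k 0 ≤ a' 0 := ha' 0
    have hk1 : k 1 ≤ a' 1 := ha' 1
    have hk2 : k 2 ≤ a' 2 := ha' 2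
    have ht : 0 ≤ t + (a 0 / (p + q) : ℕ) := by
      by_contra! ht
      zify at hlt
      push_cast at ht
      nlinarith
    lift t + (a 0 / (p + q) : ℕ) to ℕ using ht with s hs
    obtain rfl : t = s - (a 0 / (p + q) : ℕ) := by rw [hs]; ring
    push_cast at ht0 ht1 ht2
    refine ⟨s, ?_, ?_, ?_⟩ <;> zify <;> linarith
  · rintro ⟨t, ht0, ht1, ht2⟩
    refine ⟨![a 0 % (p + q) + t * (p + q), a 1 + a 0 / (p + q) * q - t * q,
      a 2 + a 0 / (p + q) * p - t * p], ⟨t - a 0 / (p + q), ?_, ?_, ?_⟩, ?_⟩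
    · simp only [Matrix.cons_val]; push_cast; linarith
    · simp only [Matrix.cons_val]; rw [Nat.cast_sub (by omega)]; push_cast; linarith
    · simp only [Matrix.cons_val]; rw [Nat.cast_sub (by omega)]; push_cast; linarith
    · intro i
      fin_cases i <;>
        simp only [Fin.zero_eta, Fin.mk_one, Fin.reduceFinMk, Matrix.cons_val] <;> omega

theorem IsTranslate.eq_of_lt {b b' : Fin 3 → ℕ} (h : IsTranslate p q b b') (hb : b 0 < p + q)
    (hb' : b' 0 < p + q) : b = b' := by
  obtain ⟨t, h0, h1, h2⟩ := h
  obtain rfl : t = 0 := by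
    by_contra ht
    zify at hb hb'
    rcases lt_or_gt_of_ne ht with ht | ht <;> nlinarith
  simp only [zero_mul, add_zero, sub_zero, Nat.cast_inj] at h0 h1 h2
  ext i
  fin_cases i
  exacts [h0.symm, h1.symm, h2.symm]

theorem IsTranslate.eq_of_le {b k k' : Fin 3 → ℕ} (h : IsTranslate p q k k')
    (hpq : b 1 < q ∨ b 2 < p) (hk : k ≤ b) (hk' : k' ≤ b) : k = k' := by
  obtain ⟨t, h0, h1, h2⟩ := h
  have hk1 : k 1 ≤ b 1 := hk 1
  have hk2 : k 2 ≤ b 2 := hk 2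
  have hk1' : k' 1 ≤ b 1 := hk' 1
  have hk2' : k' 2 ≤ b 2 := hk' 2
  obtain rfl : t = 0 := by
    by_contra ht
    zify at hpq hk1 hk2 hk1' hk2'
    rcases lt_or_gt_of_ne ht with ht | ht <;> rcases hpq with hpq | hpq <;> nlinarith
  simp only [zero_mul, add_zero, sub_zero, Nat.cast_inj] at h0 h1 h2
  ext i
  fin_cases i
  exacts [h0.symm, h1.symm, h2.symm]

theorem isBelowTranslate_iff_le {b k : Fin 3 → ℕ} (hpq : b 1 < q ∨ b 2 < p) :
    IsBelowTranslate p q b k ↔ k ≤ b := by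
  constructor
  · rintro ⟨_ | t, h0, h1, h2⟩
    · simp only [zero_mul, add_zero] at h0 h1 h2
      intro i
      fin_cases i
      exacts [h0, h1, h2]
    · simp only [add_mul] at *
      omega
  · exact fun h => ⟨0, by simpa using h 0, by simpa using h 1, by simpa using h 2⟩

end Translation

section Gorenstein

open MvPolynomial

variable {K A : Type*} [Field K] [CommRing A] [Algebra K A] {𝒜 : ℕ → Submodule K A}
  {g : Fin 3 → ℕ} {y : Fin 3 → A} {p q : ℕ} {b : Fin 3 → ℕ}

theorem MonomialGrading.binomialGrading (h : MonomialGrading 𝒜 g y)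
    (hg : ∀ b b', EqDegreeWeight g b b' ↔ IsTranslate p q b b') (hb0 : b 0 < p + q)
    (hb1 : q ≤ b 1) (hb2 : p ≤ b 2)
    (hb : ∀ k : Fin 3 → ℕ, ∏ i, y i ^ k i ≠ 0 ↔ IsBelowTranslate p q b k) :
    BinomialGrading 𝒜 1 ![p + q, b 1 + 1, b 2 + 1] ![p + q - (b 0 + 1), q, p] y := by
  have eq_zero (k₀ k₁ k₂ : ℕ)
      (hk : ∀ t, k₀ ≤ b 0 + t * (p + q) → k₁ + t * q ≤ b 1 → ¬ k₂ + t * p ≤ b 2) :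
      y 0 ^ k₀ * y 1 ^ k₁ * y 2 ^ k₂ = 0 := by
    by_contra hne
    obtain ⟨t, h0, h1, h2⟩ := (hb ![k₀, k₁, k₂]).1 (by rwa [Fin.prod_univ_three])
    exact hk t h0 h1 h2
  have hd0 : p + q - (p + q - (b 0 + 1)) = b 0 + 1 := by omega
  refine ⟨⟨?_, ?_, ?_, ?_, ?_⟩, ?_, ?_, ?_, ?_, h.grading, ?_⟩
  · have := h.prod_pow_eq ![p + q, 0, 0] ![0, q, p] ((hg _ _).2 ⟨-1, by simp⟩)
    simpa [Fin.prod_univ_three] using this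
  · simpa using eq_zero 0 (b 1 + 1) 0 (by omega)
  · simpa using eq_zero 0 0 (b 2 + 1) (by omega)
  · have := eq_zero (b 0 + 1) (b 1 + 1 - q) 0 (by rintro (_ | t) <;> grind)
    simpa [hd0] using this
  · have := eq_zero (b 0 + 1) 0 (b 2 + 1 - p) (by rintro (_ | t) <;> grind)
    simpa [hd0] using this
  · simp only [Fin.forall_fin_succ, IsEmpty.forall_iff, and_true, Matrix.cons_val_zero,
      Matrix.cons_val_succ, Matrix.cons_val_fin_one]
    omega
  · simp only [Matrix.cons_val]
    omega
  · simp only [Pi.le_def, Fin.forall_fin_succ, IsEmpty.forall_iff, and_true, Matrix.cons_val_zero,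
      Matrix.cons_val_succ, Matrix.cons_val_fin_one]
    omega
  · simp [add_comm]
  · refine h.linearIndepOn (normalExponents _ _) (fun k hk => (hb k).2 ?_)
      fun k hk k' hk' hkk' h => hkk' (((hg k k').1 h).eq_of_lt ?_ ?_)
    · simp only [Finset.mem_coe, mem_normalExponents] at hk
      obtain ⟨hlt, h | ⟨h1, h2⟩⟩ := hk
      · refine ⟨0, ?_⟩
        have := hlt 1
        have := hlt 2
        simp only [Matrix.cons_val, zero_mul, add_zero] at *
        omega
      · refine ⟨1, ?_⟩
        have := hlt 0
        simp only [Matrix.cons_val, one_mul] at *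
        omega
    · exact (mem_normalExponents.1 hk).1 0
    · exact (mem_normalExponents.1 hk').1 0

theorem MonomialGrading.binomialGrading_comp_perm (h : MonomialGrading 𝒜 g y)
    (hg : ∀ b b', EqDegreeWeight g b b' ↔ IsTranslate p q b b') (hpq : b 1 < q ∨ b 2 < p)
    (hb : ∀ k : Fin 3 → ℕ, ∏ i, y i ^ k i ≠ 0 ↔ k ≤ b) {τ : Equiv.Perm (Fin 3)}
    (hτ1 : b (τ 1) ≤ b (τ 0)) (hτ2 : b (τ 0) ≤ b (τ 2)) :
    BinomialGrading 𝒜 1 (fun i => b (τ i) + 1) ![0, b (τ 1) + 1, b (τ 0) - b (τ 1)] (y ∘ τ) := by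
  -- Here the algebra is a monomial complete intersection: both sides of the binomial relation
  -- vanish, and the last exponent is chosen to satisfy `d 0 = α 1 + α 2`.
  have pow_eq_zero (i) : (y ∘ τ) i ^ (b (τ i) + 1) = 0 := by
    by_contra hne
    have h := (hb (Pi.single (τ i) (b (τ i) + 1))).1 (by
      rwa [Fintype.prod_eq_single (τ i) fun j hj => by rw [Pi.single_eq_of_ne hj, pow_zero],
        Pi.single_eq_same])
    simpa using h (τ i)
  refine ⟨⟨?_, pow_eq_zero 1, pow_eq_zero 2, ?_, ?_⟩, fun _ => Nat.succ_pos _, Nat.succ_pos _,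
    ?_, ?_, fun k => ?_, ?_⟩
  · rw [pow_eq_zero, Matrix.cons_val_one, Matrix.cons_val_zero, pow_eq_zero, zero_mul, smul_zero]
  · exact mul_eq_zero_of_left (pow_eq_zero 0) _
  · exact mul_eq_zero_of_left (pow_eq_zero 0) _
  · simp only [Pi.le_def, Fin.forall_fin_succ, Fin.succ_zero_eq_one, Fin.succ_one_eq_two,
      IsEmpty.forall_iff, and_true, Matrix.cons_val_zero, Matrix.cons_val_succ,
      Matrix.cons_val_fin_one]
    omega
  · simp only [Matrix.cons_val]
    omega
  · rw [map_aeval_comp_perm, h.grading]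
  · have hli : LinearIndepOn K (fun k : Fin 3 → ℕ => ∏ i, y i ^ k i) {k | k ≤ b} :=
      h.linearIndepOn _ (fun k hk => (hb k).2 hk)
        fun k hk k' hk' hkk' h => hkk' (((hg k k').1 h).eq_of_le hpq hk hk')
    let f (k : normalExponents (fun i => b (τ i) + 1) ![0, b (τ 1) + 1, b (τ 0) - b (τ 1)]) :
        {k | k ≤ b} := ⟨k.1 ∘ τ.symm, fun i => by
      simpa using Nat.lt_succ_iff.1 ((mem_normalExponents.1 k.2).1 (τ.symm i))⟩
    have hf : Function.Injective f := fun k k' hkk' => Subtype.ext <|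
      τ.symm.surjective.injective_comp_right (congrArg Subtype.val hkk')
    convert hli.comp f hf using 2 with k
    simpa [f] using Equiv.prod_comp τ fun i => y i ^ k.1 (τ.symm i)

theorem exists_perm_le_le (b : Fin 3 → ℕ) :
    ∃ τ : Equiv.Perm (Fin 3), b (τ 1) ≤ b (τ 0) ∧ b (τ 0) ≤ b (τ 2) :=
  ⟨(Equiv.swap 0 1).trans (Tuple.sort b), by
    simpa using Tuple.monotone_sort b (Fin.zero_le 1), by
    simpa [Equiv.swap_apply_def] using Tuple.monotone_sort b (by decide : (1 : Fin 3) ≤ 2)⟩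

theorem MonomialGrading.exists_binomialGrading (h : MonomialGrading 𝒜 g y) (h1 : g 1 < g 0)
    (h2 : g 0 < g 2) (hfin : {b : Fin 3 → ℕ | ∏ i, y i ^ b i ≠ 0}.Finite)
    (hGor : IsGradedGorenstein 𝒜) :
    ∃ (τ : Equiv.Perm (Fin 3)) (d α : Fin 3 → ℕ), BinomialGrading 𝒜 1 d α (y ∘ τ) := by
  obtain ⟨p, q, hp, hg⟩ := exists_eqDegreeWeight_iff_isTranslate h1 h2
  obtain ⟨a, ha⟩ := h.exists_prod_pow_ne_zero_iff hfin hGor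
  obtain ⟨b, hb0, hab⟩ := exists_isTranslate_iff_isBelowTranslate hp a (q := q)
  have hb (k : Fin 3 → ℕ) : ∏ i, y i ^ k i ≠ 0 ↔ IsBelowTranslate p q b k := by
    simp only [ha, hg, hab]
  by_cases hpq : q ≤ b 1 ∧ p ≤ b 2
  · exact ⟨1, _, _, h.binomialGrading hg hb0 hpq.1 hpq.2 hb⟩
  · rw [not_and_or, not_le, not_le] at hpq
    obtain ⟨τ, hτ1, hτ2⟩ := exists_perm_le_le b
    exact ⟨τ, _, _, h.binomialGrading_comp_perm hg hpq
      (fun k => (hb k).trans (isBelowTranslate_iff_le hpq)) hτ1 hτ2⟩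

end Gorenstein

section OrderFiltration

open Pointwise

/-- The elements of order at least `i`: the sums of `i` nonzero elements and a further element. -/
def orderFiltration (M : Type*) [AddCommMonoid M] : ℕ → Set M
  | 0 => Set.univ
  | i + 1 => {0}ᶜ + orderFiltration M i

variable {M : Type*} [AddCommMonoid M] {i j : ℕ} {s t : M}

theorem add_mem_orderFiltration_of_right (s : M) (ht : t ∈ orderFiltration M j) :
    s + t ∈ orderFiltration M j := by
  induction j generalizing t with
  | zero => exact Set.mem_univ _
  | succ j ih =>
    obtain ⟨a, ha, b, hb, rfl⟩ := ht
    exact ⟨a, ha, s + b, ih hb, add_left_comm a s b⟩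

theorem add_mem_orderFiltration (hs : s ∈ orderFiltration M i) (ht : t ∈ orderFiltration M j) :
    s + t ∈ orderFiltration M (i + j) := by
  induction i generalizing s with
  | zero => rw [Nat.zero_add]; exact add_mem_orderFiltration_of_right s ht
  | succ i ih =>
    obtain ⟨a, ha, b, hb, rfl⟩ := hs
    rw [Nat.add_right_comm]
    exact ⟨a, ha, b + t, ih hb, (add_assoc a b t).symm⟩

theorem orderFiltration_antitone : Antitone (orderFiltration M) := by
  refine antitone_nat_of_succ_le fun i => ?_
  rintro _ ⟨a, -, b, hb, rfl⟩
  exact add_mem_orderFiltration_of_right a hb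

theorem mem_orderFiltration_one (hs : s ≠ 0) : s ∈ orderFiltration M 1 :=
  ⟨s, hs, 0, Set.mem_univ _, add_zero s⟩

theorem sum_nsmul_mem_orderFiltration {σ : Type*} {g : σ → M} (hg : ∀ j, g j ≠ 0) (b : σ → ℕ)
    (T : Finset σ) : ∑ j ∈ T, b j • g j ∈ orderFiltration M (∑ j ∈ T, b j) := by
  have nsmul_mem (k : ℕ) (j : σ) : k • g j ∈ orderFiltration M k := by
    induction k with
    | zero => exact Set.mem_univ _
    | succ k ih =>
      rw [succ_nsmul]
      exact add_mem_orderFiltration ih (mem_orderFiltration_one (hg j))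
  induction T using Finset.cons_induction with
  | empty => exact Set.mem_univ _
  | cons j T hj ih =>
    rw [Finset.sum_cons, Finset.sum_cons]
    exact add_mem_orderFiltration (nsmul_mem _ j) ih

theorem span_image_pow {R : Type*} [CommRing R] {φ : M → R} (map_zero : φ 0 = 1)
    (map_add : ∀ s t, φ (s + t) = φ s * φ t) (i : ℕ) :
    Ideal.span (φ '' {0}ᶜ) ^ i = Ideal.span (φ '' orderFiltration M i) := by
  induction i with
  | zero =>
    rw [pow_zero, Ideal.one_eq_top, eq_comm, Ideal.eq_top_iff_one]
    exact Ideal.subset_span ⟨0, Set.mem_univ _, map_zero⟩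
  | succ i ih =>
    rw [pow_succ', ih, Ideal.span_mul_span']
    congr 1
    exact (Set.image_image2_distrib map_add).symm

end OrderFiltration

section HasAperyOrder

variable {S : AddSubmonoid ℕ} {n i j : ℕ} {s : S}

/-- `s` is an element of order `i` of the Apéry set `Ap(S, n)`. -/
structure HasAperyOrder (S : AddSubmonoid ℕ) (n i : ℕ) (s : S) : Prop where
  mem_aperySet : (s : ℕ) ∈ aperySet S n
  mem_orderFiltration : s ∈ orderFiltration S i
  notMem_orderFiltration : s ∉ orderFiltration S (i + 1)

theorem mem_aperySet_of_add_mem {a b : S} (h : ((a + b : S) : ℕ) ∈ aperySet S n) :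
    (a : ℕ) ∈ aperySet S n := by
  refine ⟨a.2, ?_⟩
  rintro ⟨u, hu, ha⟩
  exact h.2 ⟨u + b, S.add_mem hu b.2, by rw [S.coe_add, ha]; ring⟩

namespace HasAperyOrder

theorem order_unique (h : HasAperyOrder S n i s) (h' : HasAperyOrder S n j s) : i = j := by
  by_contra hne
  rcases lt_or_gt_of_ne hne with hij | hji
  · exact h.notMem_orderFiltration (orderFiltration_antitone hij h'.mem_orderFiltration)
  · exact h'.notMem_orderFiltration (orderFiltration_antitone hji h.mem_orderFiltration)

theorem eq_zero (h : HasAperyOrder S n 0 s) : s = 0 := by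
  by_contra hs
  exact h.notMem_orderFiltration (mem_orderFiltration_one hs)

theorem ne_zero (h : HasAperyOrder S n 1 s) : s ≠ 0 := by
  rintro rfl
  obtain ⟨a, ha, b, -, hab⟩ := h.mem_orderFiltration
  exact ha (Subtype.ext (Nat.eq_zero_of_add_eq_zero_right (congrArg Subtype.val hab)))

theorem exists_eq_add (h : HasAperyOrder S n (i + 1) s) :
    ∃ a b, HasAperyOrder S n 1 a ∧ HasAperyOrder S n i b ∧ s = a + b := by
  obtain ⟨a, ha, b, hb, hab⟩ := h.mem_orderFiltration
  obtain rfl : a + b = s := hab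
  refine ⟨a, b, ⟨mem_aperySet_of_add_mem h.mem_aperySet, mem_orderFiltration_one ha, fun ha2 => ?_⟩,
    ⟨mem_aperySet_of_add_mem (add_comm a b ▸ h.mem_aperySet), hb, fun hb1 => ?_⟩, rfl⟩
  · refine h.notMem_orderFiltration ?_
    rw [add_assoc, add_comm i]
    exact add_mem_orderFiltration ha2 hb
  · exact h.notMem_orderFiltration ⟨a, ha, b, hb1, rfl⟩

theorem exists_sum_nsmul_eq {σ : Type*} [Fintype σ] {g : σ → S}
    (hg : ∀ s, HasAperyOrder S n 1 s → s ∈ Set.range g) (h : HasAperyOrder S n i s) :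
    ∃ b : σ → ℕ, ∑ j, b j = i ∧ ∑ j, b j • g j = s := by
  classical
  induction i generalizing s with
  | zero => exact ⟨0, by simp, by simp [h.eq_zero]⟩
  | succ i ih =>
    obtain ⟨_, _, ha, hb, rfl⟩ := h.exists_eq_add
    obtain ⟨b, rfl, rfl⟩ := ih hb
    obtain ⟨j, rfl⟩ := hg _ ha
    refine ⟨Pi.single j 1 + b, ?_, ?_⟩
    · simp [Finset.sum_add_distrib, add_comm]
    · simp [add_smul, Finset.sum_add_distrib, Pi.single_apply, ite_smul]

end HasAperyOrder

end HasAperyOrder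

section AperyRing

variable {K : Type*} [Field K] {S : AddSubmonoid ℕ} {n : ℕ}

theorem exists_linearMap_quotient_mk_eq {R V : Type*} [CommRing R] [Algebra K R] [AddCommGroup V]
    [Module K V] {I : Ideal R} (f : R →ₗ[K] V) (hf : ∀ r ∈ I, f r = 0) :
    ∃ φ : R ⧸ I →ₗ[K] V, ∀ r, φ (Ideal.Quotient.mk I r) = f r :=
  ⟨(I.restrictScalars K).liftQ f hf ∘ₗ (Submodule.Quotient.restrictScalarsEquiv K I).symm,
    fun _ => rfl⟩

/-- The class of `t ^ s` in `AperyRing K S n`. -/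
def aperyMonomial (K : Type*) [Field K] {S : AddSubmonoid ℕ} (n : ℕ) (s : S) : AperyRing K S n :=
  Ideal.Quotient.mk (aperyIdeal K S n) (semigroupMonomial K S s)

theorem aperyMonomial_add (s t : S) :
    aperyMonomial K n (s + t) = aperyMonomial K n s * aperyMonomial K n t := by
  rw [aperyMonomial, aperyMonomial, aperyMonomial, ← map_mul, semigroupMonomial, semigroupMonomial,
    semigroupMonomial, AddMonoidAlgebra.single_mul_single, one_mul]

theorem aperyMonomial_zero : aperyMonomial K n (0 : S) = 1 := rfl

theorem aperyMonomial_sum_nsmul {σ : Type*} (g : σ → S) (b : σ → ℕ) (T : Finset σ) :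
    aperyMonomial K n (∑ j ∈ T, b j • g j) = ∏ j ∈ T, aperyMonomial K n (g j) ^ b j := by
  let φ : Multiplicative S →* AperyRing K S n :=
    ⟨⟨fun s => aperyMonomial K n s.toAdd, aperyMonomial_zero⟩, aperyMonomial_add⟩
  exact (map_prod φ (fun j => Multiplicative.ofAdd (g j) ^ b j) T).trans
    (Finset.prod_congr rfl fun j _ => map_pow φ _ _)

theorem aperyMonomial_eq_zero {s : S} (hs : (s : ℕ) ∉ aperySet S n) : aperyMonomial K n s = 0 :=
  Ideal.Quotient.eq_zero_iff_mem.2 (Ideal.subset_span ⟨s, hs, rfl⟩)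

theorem span_range_aperyMonomial :
    Submodule.span K (Set.range (aperyMonomial K (S := S) n)) = ⊤ := by
  have h := congrArg (Submodule.map (Ideal.Quotient.mkₐ K (aperyIdeal K S n)).toLinearMap)
    (AddMonoidAlgebra.basis S K).span_eq
  rwa [Submodule.map_span, ← Set.range_comp, Submodule.map_top, LinearMap.range_eq_top.2
    Ideal.Quotient.mk_surjective] at h

theorem exists_linearMap_aperyMonomial_eq {s : S} (hs : (s : ℕ) ∈ aperySet S n) :
    ∃ φ : AperyRing K S n →ₗ[K] K, ∀ t : S, φ (aperyMonomial K n t) = if t = s then 1 else 0 := by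
  have hzero (f : AddMonoidAlgebra K S) (hf : f ∈ aperyIdeal K S n) :
      (AddMonoidAlgebra.basis S K).coord s f = 0 := by
    by_contra hfs
    obtain ⟨t, ht, u, rfl⟩ := AddMonoidAlgebra.mem_ideal_span_of'_image.1 hf s
      (Finsupp.mem_support_iff.2 hfs)
    exact ht (mem_aperySet_of_add_mem (add_comm u t ▸ hs))
  obtain ⟨φ, hφ⟩ := exists_linearMap_quotient_mk_eq _ hzero
  refine ⟨φ, fun t => (hφ _).trans ?_⟩
  rw [semigroupMonomial, ← AddMonoidAlgebra.basis_apply, Module.Basis.coord_apply,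
    Module.Basis.repr_self, Finsupp.single_apply]

theorem aperyMaximalIdeal_eq_span :
    aperyMaximalIdeal K S n = Ideal.span (aperyMonomial K (S := S) n '' {0}ᶜ) := by
  rw [aperyMaximalIdeal, Ideal.map_span, Set.image_image]
  rfl

theorem restrictScalars_aperyMaximalIdeal_pow (i : ℕ) :
    (aperyMaximalIdeal K S n ^ i).restrictScalars K =
      Submodule.span K (aperyMonomial K n '' orderFiltration S i) := by
  rw [aperyMaximalIdeal_eq_span, span_image_pow aperyMonomial_zero aperyMonomial_add, Ideal.span,
    ← Submodule.span_smul_of_span_eq_top span_range_aperyMonomial]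
  congr 1
  refine Set.Subset.antisymm ?_ fun x hx =>
    ⟨1, ⟨0, aperyMonomial_zero⟩, x, hx, one_mul x⟩
  rintro _ ⟨_, ⟨s, rfl⟩, _, ⟨t, ht, rfl⟩, rfl⟩
  exact ⟨s + t, add_mem_orderFiltration_of_right s ht, aperyMonomial_add s t⟩

end AperyRing

section AssociatedGraded

variable {Q : Type*} [CommRing Q] {I : Ideal Q} {i : ℕ}

theorem coeff_mem_pow_succ_of_mem_map {x : reesAlgebra I}
    (hx : x ∈ I.map (algebraMap Q (reesAlgebra I))) (i : ℕ) : x.1.coeff i ∈ I ^ (i + 1) := by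
  let J : Ideal (reesAlgebra I) :=
    { carrier := {x | ∀ i, x.1.coeff i ∈ I ^ (i + 1)}
      zero_mem' := fun _ => Ideal.zero_mem _
      add_mem' := fun {x y} hx hy i =>
        Polynomial.coeff_add x.1 y.1 i ▸ Ideal.add_mem _ (hx i) (hy i)
      smul_mem' := fun a x hx i => by
        change (a.1 * x.1).coeff i ∈ _
        rw [Polynomial.coeff_mul]
        refine Ideal.sum_mem _ fun p hp => ?_
        rw [← Finset.HasAntidiagonal.mem_antidiagonal.1 hp, add_assoc, pow_add]
        exact Ideal.mul_mem_mul (a.2 p.1) (hx p.2) }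
  have hJ : I.map (algebraMap Q (reesAlgebra I)) ≤ J := Ideal.map_le_iff_le_comap.2 fun a ha i => by
    change (Polynomial.C a).coeff i ∈ _
    rw [Polynomial.coeff_C]
    split_ifs with hi
    · rwa [hi, zero_add, pow_one]
    · exact Ideal.zero_mem _
  exact hJ hx i

theorem monomial_mem_map {r : Q} (hr : r ∈ I ^ (i + 1))
    (h : Polynomial.monomial i r ∈ reesAlgebra I) :
    (⟨Polynomial.monomial i r, h⟩ : reesAlgebra I) ∈ I.map (algebraMap Q (reesAlgebra I)) := by
  have hle : I * I ^ i ≤ (((I.map (algebraMap Q (reesAlgebra I))).restrictScalars Q).map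
      (reesAlgebra I).val.toLinearMap).comap (Polynomial.monomial i) :=
    Ideal.mul_le.2 fun a ha b hb =>
      ⟨algebraMap Q _ a * ⟨Polynomial.monomial i b, reesAlgebra.monomial_mem.2 hb⟩,
        Ideal.mul_mem_right _ _ (Ideal.mem_map_of_mem _ ha), by
          change Polynomial.C a * Polynomial.monomial i b = _
          rw [Polynomial.C_mul_monomial]⟩
  obtain ⟨x, hx, hxr⟩ := hle (pow_succ' I i ▸ hr)
  obtain rfl : x = ⟨_, h⟩ := Subtype.ext hxr
  exact hx

variable {K : Type*} [Field K] [Algebra K Q]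

/-- The class in `Iⁱ / Iⁱ⁺¹` of an element of `Iⁱ`. -/
def associatedGradedClass (K : Type*) [Field K] {Q : Type*} [CommRing Q] [Algebra K Q]
    (I : Ideal Q) (i : ℕ) : (I ^ i).restrictScalars K →ₗ[K] AssociatedGradedRing I :=
  (associatedGradedMk K I).toLinearMap ∘ₗ
    { toFun := fun r => ⟨Polynomial.monomial i r, reesAlgebra.monomial_mem.2 r.2⟩
      map_add' := fun r s => Subtype.ext ((Polynomial.monomial i).map_add r.1 s.1)
      map_smul' := fun c r => Subtype.ext (Polynomial.smul_monomial c i r.1).symm }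

theorem associatedGradedClass_eq_zero {r : (I ^ i).restrictScalars K} (hr : r.1 ∈ I ^ (i + 1)) :
    associatedGradedClass K I i r = 0 :=
  Ideal.Quotient.eq_zero_iff_mem.2 (monomial_mem_map hr _)

theorem range_associatedGradedClass :
    LinearMap.range (associatedGradedClass K I i) = associatedGradedPiece K I i := by
  refine le_antisymm ?_ ?_
  · rintro _ ⟨r, rfl⟩
    exact ⟨_, ⟨r.1, rfl⟩, rfl⟩
  · rintro _ ⟨x, ⟨r, hr⟩, rfl⟩
    have hr' : Polynomial.monomial i r = x.1 := hr
    exact ⟨⟨r, reesAlgebra.monomial_mem.1 (hr' ▸ x.2)⟩,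
      congrArg (associatedGradedMk K I) (Subtype.ext hr')⟩

theorem iSup_associatedGradedPiece : ⨆ i, associatedGradedPiece K I i = ⊤ := by
  refine eq_top_iff.2 fun a _ => ?_
  obtain ⟨x, rfl⟩ : ∃ x, associatedGradedMk K I x = a := Ideal.Quotient.mk_surjective a
  have hx : x = ∑ i ∈ x.1.support,
      ⟨Polynomial.monomial i (x.1.coeff i), reesAlgebra.monomial_mem.2 (x.2 i)⟩ := by
    apply Subtype.ext
    rw [AddSubmonoidClass.coe_finsetSum]
    exact x.1.as_sum_support
  rw [hx, map_sum]
  exact Submodule.sum_mem _ fun i _ => Submodule.mem_iSup_of_mem i ⟨_, ⟨x.1.coeff i, rfl⟩, rfl⟩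

theorem exists_linearMap_associatedGradedClass_eq {ψ : Q →ₗ[K] K}
    (hψ : ∀ r ∈ I ^ (i + 1), ψ r = 0) : ∃ φ : AssociatedGradedRing I →ₗ[K] K,
      ∀ j r, φ (associatedGradedClass K I j r) = if j = i then ψ r else 0 := by
  obtain ⟨φ, hφ⟩ := exists_linearMap_quotient_mk_eq (I := I.map (algebraMap Q (reesAlgebra I)))
    (ψ ∘ₗ (Polynomial.lcoeff Q i).restrictScalars K ∘ₗ
      ((reesAlgebra I).val.restrictScalars K).toLinearMap)
    fun x hx => hψ _ (coeff_mem_pow_succ_of_mem_map hx i)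
  refine ⟨φ, fun j r => (hφ _).trans ?_⟩
  change ψ ((Polynomial.monomial j r.1).coeff i) = _
  rw [Polynomial.coeff_monomial, apply_ite ψ, map_zero]

end AssociatedGraded

section AperyClass

variable {K : Type*} [Field K] {S : AddSubmonoid ℕ} {n i : ℕ} {s : S}

theorem aperyMonomial_mem_pow (hs : s ∈ orderFiltration S i) :
    aperyMonomial K n s ∈ (aperyMaximalIdeal K S n ^ i).restrictScalars K := by
  rw [restrictScalars_aperyMaximalIdeal_pow]
  exact Submodule.subset_span ⟨s, hs, rfl⟩

open Classical in
/-- The class of `t ^ s` in the component of degree `i` of `AperyAlgebra K S n`, for `s` of order at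
least `i`; zero for all other `s`. -/
def aperyClass (K : Type*) [Field K] {S : AddSubmonoid ℕ} (n i : ℕ) (s : S) : AperyAlgebra K S n :=
  if hs : s ∈ orderFiltration S i then
    associatedGradedClass K (aperyMaximalIdeal K S n) i
      ⟨aperyMonomial K n s, aperyMonomial_mem_pow hs⟩
  else 0

theorem aperyClass_of_mem (hs : s ∈ orderFiltration S i) : aperyClass K n i s =
    associatedGradedClass K (aperyMaximalIdeal K S n) i
      ⟨aperyMonomial K n s, aperyMonomial_mem_pow hs⟩ :=
  dif_pos hs

theorem aperyClass_eq_zero (hs : ¬HasAperyOrder S n i s) : aperyClass K n i s = 0 := by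
  by_cases hi : s ∈ orderFiltration S i
  · rw [aperyClass_of_mem hi]
    apply associatedGradedClass_eq_zero
    by_cases hi' : s ∈ orderFiltration S (i + 1)
    · exact aperyMonomial_mem_pow hi'
    · have hap : (s : ℕ) ∉ aperySet S n := fun hap => hs ⟨hap, hi, hi'⟩
      change aperyMonomial K n s ∈ _
      rw [aperyMonomial_eq_zero hap]
      exact Ideal.zero_mem _
  · exact dif_neg hi

theorem HasAperyOrder.exists_linearMap_aperyClass_eq (hs : HasAperyOrder S n i s) :
    ∃ φ : AperyAlgebra K S n →ₗ[K] K, φ (aperyClass K n i s) = 1 ∧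
      ∀ j t, t ≠ s → φ (aperyClass K n j t) = 0 := by
  obtain ⟨ψ, hψ⟩ := exists_linearMap_aperyMonomial_eq (K := K) hs.mem_aperySet
  have hpow : (aperyMaximalIdeal K S n ^ (i + 1)).restrictScalars K ≤ LinearMap.ker ψ := by
    rw [restrictScalars_aperyMaximalIdeal_pow, Submodule.span_le]
    rintro _ ⟨t, ht, rfl⟩
    refine (hψ t).trans (if_neg ?_)
    rintro rfl
    exact hs.notMem_orderFiltration ht
  obtain ⟨φ, hφ⟩ := exists_linearMap_associatedGradedClass_eq hpow
  refine ⟨φ, ?_, fun j t hts => ?_⟩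
  · rw [aperyClass_of_mem hs.mem_orderFiltration, hφ, if_pos rfl, hψ, if_pos rfl]
  · by_cases ht : t ∈ orderFiltration S j
    · rw [aperyClass_of_mem ht, hφ, hψ, if_neg hts, ite_self]
    · rw [aperyClass, dif_neg ht, map_zero]

theorem aperyClass_ne_zero_iff : aperyClass K n i s ≠ 0 ↔ HasAperyOrder S n i s := by
  refine ⟨fun h => by_contra fun hs => h (aperyClass_eq_zero hs), fun hs h0 => ?_⟩
  obtain ⟨φ, hφ, -⟩ := hs.exists_linearMap_aperyClass_eq (K := K)
  rw [h0, map_zero] at hφ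
  exact zero_ne_one hφ

theorem linearIndependent_aperyClass {ι : Type*} {i : ι → ℕ} {s : ι → S}
    (hs : Function.Injective s) (h : ∀ x, HasAperyOrder S n (i x) (s x)) :
    LinearIndependent K fun x => aperyClass K n (i x) (s x) := by
  choose φ hφ hφ' using fun x => HasAperyOrder.exists_linearMap_aperyClass_eq (K := K) (h x)
  exact .of_pairwise_dual_eq_zero_one _ φ (fun x y hxy => hφ' x _ _ (hs.ne hxy.symm)) hφ

theorem aperyGrading_eq_span (i : ℕ) : aperyGrading K S n i =
    Submodule.span K (Set.range fun s : {s // HasAperyOrder S n i s} => aperyClass K n i s.1) := by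
  rw [aperyGrading, ← range_associatedGradedClass]
  refine le_antisymm ?_ (Submodule.span_le.2 ?_)
  · let L := associatedGradedClass K (aperyMaximalIdeal K S n) i
    let W := Submodule.span K
      (Set.range fun s : {s // HasAperyOrder S n i s} => aperyClass K n i s.1)
    have hle : (aperyMaximalIdeal K S n ^ i).restrictScalars K ≤
        (W.comap L).map ((aperyMaximalIdeal K S n ^ i).restrictScalars K).subtype := by
      rw (occs := .pos [1]) [restrictScalars_aperyMaximalIdeal_pow, Submodule.span_le]
      rintro _ ⟨s, hs, rfl⟩
      refine ⟨⟨_, aperyMonomial_mem_pow hs⟩, ?_, rfl⟩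
      rw [SetLike.mem_coe, Submodule.mem_comap, ← aperyClass_of_mem hs]
      by_cases h : HasAperyOrder S n i s
      · exact Submodule.subset_span ⟨⟨s, h⟩, rfl⟩
      · exact aperyClass_eq_zero (K := K) h ▸ W.zero_mem
    rintro _ ⟨r, rfl⟩
    obtain ⟨r', hr', hrr'⟩ := hle r.2
    obtain rfl : r' = r := Subtype.ext hrr'
    exact hr'
  · rintro _ ⟨s, rfl⟩
    exact ⟨_, (aperyClass_of_mem s.2.mem_orderFiltration).symm⟩

theorem prod_monomial_one_pow {R σ : Type*} [CommSemiring R] (r : σ → R) (b : σ → ℕ)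
    (T : Finset σ) : ∏ j ∈ T, Polynomial.monomial 1 (r j) ^ b j =
      Polynomial.monomial (∑ j ∈ T, b j) (∏ j ∈ T, r j ^ b j) := by
  simp only [← Polynomial.C_mul_X_pow_eq_monomial, pow_one, mul_pow, Finset.prod_mul_distrib,
    Finset.prod_pow_eq_pow_sum, map_prod, map_pow]

theorem prod_aperyClass_pow {σ : Type*} {g : σ → S} (hg : ∀ j, g j ≠ 0) (b : σ → ℕ)
    (T : Finset σ) :
    ∏ j ∈ T, aperyClass K n 1 (g j) ^ b j = aperyClass K n (∑ j ∈ T, b j) (∑ j ∈ T, b j • g j) := by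
  have hclass (j : σ) : aperyClass K n 1 (g j) = associatedGradedMk K _
      ⟨Polynomial.monomial 1 (aperyMonomial K n (g j)),
        reesAlgebra.monomial_mem.2 (aperyMonomial_mem_pow (mem_orderFiltration_one (hg j)))⟩ :=
    aperyClass_of_mem (mem_orderFiltration_one (hg j))
  simp only [hclass, ← map_pow, ← map_prod]
  rw [aperyClass_of_mem (sum_nsmul_mem_orderFiltration hg b T)]
  refine congrArg (associatedGradedMk K _) (Subtype.ext ?_)
  refine (map_prod (reesAlgebra (aperyMaximalIdeal K S n)).val _ T).trans ?_
  simp only [map_pow]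
  exact (prod_monomial_one_pow _ b T).trans
    (congrArg (Polynomial.monomial _) (aperyMonomial_sum_nsmul g b T).symm)

end AperyClass

section AperyAlgebra

open MvPolynomial

variable {K : Type*} [Field K] {S : AddSubmonoid ℕ} {n : ℕ} {σ : Type*} {g : σ → S}

theorem aperyGrading_eq_map_aeval [Finite σ] (hg0 : ∀ j, g j ≠ 0)
    (hg : ∀ s, HasAperyOrder S n 1 s → s ∈ Set.range g) (k : ℕ) :
    aperyGrading K S n k = (homogeneousSubmodule σ K k).map
      (aeval fun j => aperyClass K n 1 (g j)).toLinearMap := by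
  cases nonempty_fintype σ
  rw [aperyGrading_eq_span]
  refine le_antisymm (Submodule.span_le.2 ?_) ?_
  · rintro _ ⟨⟨s, hs⟩, rfl⟩
    obtain ⟨b, rfl, rfl⟩ := hs.exists_sum_nsmul_eq hg
    refine ⟨∏ j, X j ^ b j, IsHomogeneous.prod _ _ _ fun j _ => isHomogeneous_X_pow j (b j), ?_⟩
    simp only [AlgHom.toLinearMap_apply, map_prod, map_pow, aeval_X, prod_aperyClass_pow hg0]
  · rintro _ ⟨p, hp, rfl⟩
    rw [AlgHom.toLinearMap_apply, aeval_def, eval₂_eq']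
    refine Submodule.sum_mem _ fun m hm => ?_
    have hdeg : ∑ j, m j = k := by
      rw [← Finsupp.degree_eq_sum, Finsupp.degree_eq_weight_one]
      exact hp (mem_support_iff.1 hm)
    rw [← Algebra.smul_def, prod_aperyClass_pow hg0, hdeg]
    refine Submodule.smul_mem _ _ ?_
    by_cases h : HasAperyOrder S n k (∑ j, m j • g j)
    · exact Submodule.subset_span ⟨⟨_, h⟩, rfl⟩
    · exact aperyClass_eq_zero (K := K) h ▸ Submodule.zero_mem _

variable [Fintype σ]

theorem monomialGrading_aperyGrading (hg0 : ∀ j, g j ≠ 0)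
    (hg : ∀ s, HasAperyOrder S n 1 s → s ∈ Set.range g) :
    MonomialGrading (aperyGrading K S n) (fun j => (g j : ℕ)) fun j => aperyClass K n 1 (g j) where
  grading := aperyGrading_eq_map_aeval hg0 hg
  prod_pow_eq := by
    rintro b b' ⟨hdeg, hweight⟩
    have hsum : ∑ j, b j • g j = ∑ j, b' j • g j := Subtype.ext (by simpa using hweight)
    rw [prod_aperyClass_pow hg0, prod_aperyClass_pow hg0, hdeg, hsum]
  linearIndepOn := by
    intro s hs hpair
    simp only [prod_aperyClass_pow hg0, ne_eq] at hs ⊢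
    have hs (b : s) : HasAperyOrder S n (∑ j, b.1 j) (∑ j, b.1 j • g j) :=
      aperyClass_ne_zero_iff.1 (hs b b.2)
    refine linearIndependent_aperyClass (fun b b' hbb' => by_contra fun hne => ?_) hs
    refine hpair b.2 b'.2 (Subtype.coe_ne_coe.2 hne) ⟨(hs b).order_unique (hbb' ▸ hs b'), ?_⟩
    simpa using congrArg Subtype.val hbb'

theorem finite_setOf_prod_aperyClass_pow_ne_zero (hfin : (aperySet S n).Finite)
    (hg0 : ∀ j, g j ≠ 0) :
    {b : σ → ℕ | ∏ j, aperyClass K n 1 (g j) ^ b j ≠ 0}.Finite := by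
  obtain ⟨N, hN⟩ := hfin.bddAbove
  refine (Set.Finite.pi' fun _ => Set.finite_Iic N).subset fun b hb j => ?_
  rw [Set.mem_ofPred_eq, prod_aperyClass_pow hg0, aperyClass_ne_zero_iff] at hb
  have hj : 0 < (g j : ℕ) := Nat.pos_of_ne_zero (mt (Subtype.ext (a1 := g j) (a2 := 0)) (hg0 j))
  calc b j ≤ b j * g j := Nat.le_mul_of_pos_right _ hj
    _ ≤ ∑ i, b i * (g i : ℕ) := Finset.single_le_sum_of_canonicallyOrdered
      (f := fun i => b i * (g i : ℕ)) (Finset.mem_univ j)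
    _ = ((∑ i, b i • g i : S) : ℕ) := by simp
    _ ≤ N := hN hb.mem_aperySet

theorem exists_orderEmbedding_range_eq (hfin : (aperySet S n).Finite) :
    ∃ g : Fin (Module.finrank K (aperyGrading K S n 1)) ↪o S,
      Set.range g = {s | HasAperyOrder S n 1 s} := by
  have hfin1 : {s : S | HasAperyOrder S n 1 s}.Finite :=
    (hfin.preimage Subtype.val_injective.injOn).subset fun s hs => hs.mem_aperySet
  have : Fintype {s // HasAperyOrder S n 1 s} := hfin1.fintype
  have hcard : hfin1.toFinset.card = Module.finrank K (aperyGrading K S n 1) := by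
    rw [aperyGrading_eq_span, finrank_span_eq_card
      (linearIndependent_aperyClass Subtype.val_injective fun s => s.2),
      ← Nat.card_eq_fintype_card]
    exact (Set.ncard_eq_toFinset_card _ hfin1).symm
  exact ⟨hfin1.toFinset.orderEmbOfFin hcard, by simp⟩

end AperyAlgebra

end

theorem exists_binomialGrading_aperyGrading {K : Type*} [Field K] {S : AddSubmonoid ℕ} {n : ℕ}
    (hfin : (aperySet S n).Finite) (hcodim : Module.finrank K (aperyGrading K S n 1) = 3)
    (hGor : IsGradedGorenstein (aperyGrading K S n)) :
    ∃ (d α : Fin 3 → ℕ) (y : Fin 3 → AperyAlgebra K S n),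
      BinomialGrading (aperyGrading K S n) 1 d α y := by
  obtain ⟨g, hg⟩ : ∃ g : Fin 3 ↪o S, Set.range g = {s | HasAperyOrder S n 1 s} :=
    hcodim ▸ exists_orderEmbedding_range_eq hfin
  let τ : Equiv.Perm (Fin 3) := Equiv.swap 0 1
  have hgτ : Set.range (g ∘ τ) = {s | HasAperyOrder S n 1 s} := (τ.surjective.range_comp g).trans hg
  have hg0 (j : Fin 3) : (g ∘ τ) j ≠ 0 :=
    HasAperyOrder.ne_zero (hgτ.subset (Set.mem_range_self j))
  obtain ⟨τ', d, α, h⟩ := (monomialGrading_aperyGrading hg0 hgτ.ge).exists_binomialGrading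
    (g.strictMono (show (0 : Fin 3) < 1 by decide)) (g.strictMono (show (1 : Fin 3) < 2 by decide))
    (finite_setOf_prod_aperyClass_pow_ne_zero hfin hg0) hGor
  exact ⟨d, α, _, h⟩

theorem finite_aperySet {S : AddSubmonoid ℕ} (hS : IsNumericalSemigroup S) (n : ℕ) :
    (aperySet S n).Finite := by
  refine (hS.image (· + n) |>.union (Set.finite_Iio n)).subset fun s hs => ?_
  by_cases hsn : s < n
  · exact .inr hsn
  · rw [not_lt] at hsn
    exact .inl ⟨s - n, fun h => hs.2 ⟨s - n, h, (Nat.sub_add_cancel hsn).symm⟩,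
      Nat.sub_add_cancel hsn⟩

theorem corollary3p3_general (K : Type*) [Field K] (S : AddSubmonoid ℕ) (n : ℕ)
    (hfin : (aperySet S n).Finite) (hcodim : Module.finrank K (aperyGrading K S n 1) = 3)
    (hGor : IsGradedGorenstein (aperyGrading K S n)) :
    (CharZero K → HasSLP (aperyGrading K S n)) ∧
      ∃ d α : Fin 3 → ℕ, (∀ j, α j ≤ d j) ∧ d 0 = α 1 + α 2 ∧
        ∃ e : AperyAlgebra K S n ≃ₐ[K] (MvPolynomial (Fin 3) K ⧸ binomialIdeal K (-1) d α),
          ∀ i, (aperyGrading K S n i).map e.toLinearMap =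
            quotientGrading (binomialIdeal K (-1) d α) i := by
  obtain ⟨d, α, y, h⟩ := exists_binomialGrading_aperyGrading hfin hcodim hGor
  exact ⟨fun _ => h.hasSLP, d, α, h.le, h.degree_eq, h.exists_algEquiv
    (aeval_surjective_of_eq_map_aeval h.grading iSup_associatedGradedPiece)⟩

theorem corollary3p3 (K : Type*) [Field K] [CharZero K]
    (S : AddSubmonoid ℕ) (hS : IsNumericalSemigroup S)
    (n : ℕ) (hn : n ∈ S) (hn0 : n ≠ 0)
    (hcodim : Module.finrank K (aperyGrading K S n 1) = 3)
    (hGor : IsGradedGorenstein (aperyGrading K S n)) :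
    HasSLP (aperyGrading K S n) ∧
      ∃ d α : Fin 3 → ℕ, (∀ j, α j ≤ d j) ∧ d 0 = α 1 + α 2 ∧
        ∃ e : AperyAlgebra K S n ≃ₐ[K] (MvPolynomial (Fin 3) K ⧸ binomialIdeal K (-1) d α),
          ∀ i, (aperyGrading K S n i).map e.toLinearMap =
            quotientGrading (binomialIdeal K (-1) d α) i :=
  (corollary3p3_general K S n (finite_aperySet hS n) hcodim hGor).imp_left fun h => h inferInstance
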